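/- \textbf{Theorem (a priori bounds in $L_{q^{**}}$).} Let $d\in\mathbb N$, let $q\ge 2$ be a real number with $q\ne d/2$, and let $\delta>0$, $L>0$. Put $q^{**}=\frac{qd}{d-2q}$ if $q<d/2$ and $q^{**}=\infty$ if $q>d/2$. Then there is a constant $C>0$, depending only on $d$, $q$, $\delta$ and $L$, with the following property. Let $\Omega\subseteq\mathbb R^d$ be an arbitrary open set and let $f:\Omega\times\mathbb R\times\mathbb R^d\to\mathbb R$ be a Carathéodory function, i.e. $x\mapsto f(x,s,\xi)$ is measurable for all $(s,\xi)$ and $(s,\xi)\mapsto f(x,s,\xi)$ is continuous for almost every $x\in\Omega$. Let $h\in L_2(\Omega)\cap L_q(\Omega)$, $h\ge 0$, and suppose that for almost every $x\in\Omega$ $$f(x,s,\xi)\,s\le \delta s^2+L|\xi s|+h(x)|s|\qquad\text{for all } s\in\mathbb R,\ \xi\in\mathbb R^d .$$ Let $\mu\ge 0$ and $0<t\le 1$, let $\omega\subseteq\Omega$ be open, let $v_0\le 0\le v_1$ be measurable real-valued functions on $\Omega$, and put $\sigma(x,s)=\max\{v_0(x),\min\{s,v_1(x)\}\}$. Let $u$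 be a weak solution of $$-\Delta u+\mu u=t\bigl(f(x,\sigma(x,u),\nabla u)+\mu\,\sigma(x,u)\bigr)\chi_\omega(x)\ \text{ in }\Omega,\qquad u=0\ \text{ on }\partial\Omega,$$ that is, $u\in H^1_0(\Omega)$ (the closure of $C_c^\infty(\Omega)$ in $H^1(\Omega)$), the function $g(x)=t\bigl(f(x,\sigma(x,u(x)),\nabla u(x))+\mu\,\sigma(x,u(x))\bigr)\chi_\omega(x)$ belongs to $L_2(\Omega)$, and $$\int_\Omega\nabla u\cdot\nabla\varphi\,dx+\mu\int_\Omega u\varphi\,dx=\int_\Omega g\,\varphi\,dx\qquad\text{for all }\varphi\in C_c^\infty(\Omega).$$ Then $u\in L_{q^{**}}(\Omega)$ and $$\|u\|_{L_{q^{**}}(\Omega)}\le C\left(\|u\|_{L_2(\Omega)}+\|h\|_{L_q(\Omega)}\right).$$ -/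

import Mathlib

open MeasureTheory Filter Topology
open scoped ENNReal ContDiff Gradient

noncomputable section

namespace SemilinearDirichlet

/-- `φ ∈ C_c^∞(Ω)`: a smooth real function on `ℝ^d` with compact support contained in `Ω`. -/
structure IsTestFunction {d : ℕ} (Ω : Set (EuclideanSpace ℝ (Fin d)))
    (φ : EuclideanSpace ℝ (Fin d) → ℝ) : Prop where
  contDiff : ContDiff ℝ ∞ φ
  hasCompactSupport : HasCompactSupport φ
  tsupport_subset : tsupport φ ⊆ Ω

/-- `u ∈ H^1(Ω)` with weak gradient `G`: both `u` and `G` are in `L_2(Ω)` and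
`∫_Ω u ∇φ = - ∫_Ω φ G` for every test function `φ`. -/
structure MemH1 {d : ℕ} (Ω : Set (EuclideanSpace ℝ (Fin d)))
    (u : EuclideanSpace ℝ (Fin d) → ℝ)
    (G : EuclideanSpace ℝ (Fin d) → EuclideanSpace ℝ (Fin d)) : Prop where
  memLp : MemLp u 2 (volume.restrict Ω)
  memLp_grad : MemLp G 2 (volume.restrict Ω)
  weak_gradient : ∀ φ : EuclideanSpace ℝ (Fin d) → ℝ, IsTestFunction Ω φ →
    ∫ x in Ω, u x • ∇ φ x = - ∫ x in Ω, φ x • G x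

/-- `u ∈ H^1_0(Ω)` with weak gradient `G`: `u` lies in the closure of `C_c^∞(Ω)` in `H^1(Ω)`. -/
structure MemH10 {d : ℕ} (Ω : Set (EuclideanSpace ℝ (Fin d)))
    (u : EuclideanSpace ℝ (Fin d) → ℝ)
    (G : EuclideanSpace ℝ (Fin d) → EuclideanSpace ℝ (Fin d)) : Prop where
  memH1 : MemH1 Ω u G
  approx : ∃ φ : ℕ → EuclideanSpace ℝ (Fin d) → ℝ, (∀ n, IsTestFunction Ω (φ n)) ∧
    Tendsto (fun n => eLpNorm (fun x => φ n x - u x) 2 (volume.restrict Ω)) atTop (𝓝 0) ∧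
    Tendsto (fun n => eLpNorm (fun x => ∇ (φ n) x - G x) 2 (volume.restrict Ω)) atTop (𝓝 0)

/-- Carathéodory function on `Ω × ℝ × ℝ^d`: (Lebesgue) measurable in `x ∈ Ω` for all fixed
`s, ξ`, and jointly continuous in `(s, ξ)` for almost every `x ∈ Ω`. -/
structure IsCaratheodory {d : ℕ} (Ω : Set (EuclideanSpace ℝ (Fin d)))
    (f : EuclideanSpace ℝ (Fin d) → ℝ → EuclideanSpace ℝ (Fin d) → ℝ) : Prop where
  measurable : ∀ (s : ℝ) (ξ : EuclideanSpace ℝ (Fin d)),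
    AEMeasurable (fun x => f x s ξ) (volume.restrict Ω)
  continuous : ∀ᵐ x ∂(volume.restrict Ω),
    Continuous (fun p : ℝ × EuclideanSpace ℝ (Fin d) => f x p.1 p.2)

/-- The coerciveness condition `f(x,s,ξ) s ≤ a s² + L |ξ s| + h(x) |s|`. -/
def IsCoercive {d : ℕ} (Ω : Set (EuclideanSpace ℝ (Fin d)))
    (f : EuclideanSpace ℝ (Fin d) → ℝ → EuclideanSpace ℝ (Fin d) → ℝ)
    (a L : ℝ) (h : EuclideanSpace ℝ (Fin d) → ℝ) : Prop :=
  ∀ᵐ x ∂(volume.restrict Ω), ∀ (s : ℝ) (ξ : EuclideanSpace ℝ (Fin d)),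
    f x s ξ * s ≤ a * s ^ 2 + L * ‖s • ξ‖ + h x * |s|

/-- The truncation `σ(x,s) = max {v₀(x), min {s, v₁(x)}}`. -/
def trunc {d : ℕ} (v₀ v₁ : EuclideanSpace ℝ (Fin d) → ℝ)
    (x : EuclideanSpace ℝ (Fin d)) (s : ℝ) : ℝ :=
  max (v₀ x) (min s (v₁ x))

/-- `b_σ(x,s,ξ) = f(x,σ(x,s),ξ) + μ σ(x,s)`. -/
def bTrunc {d : ℕ} (f : EuclideanSpace ℝ (Fin d) → ℝ → EuclideanSpace ℝ (Fin d) → ℝ)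
    (μ : ℝ) (v₀ v₁ : EuclideanSpace ℝ (Fin d) → ℝ)
    (x : EuclideanSpace ℝ (Fin d)) (s : ℝ) (ξ : EuclideanSpace ℝ (Fin d)) : ℝ :=
  f x (trunc v₀ v₁ x s) ξ + μ * trunc v₀ v₁ x s

/-- `u` is a weak solution of `-Δu + μ u = F(x,u,∇u)` in `Ω`, `u = 0` on `∂Ω`: `u ∈ H^1_0(Ω)`,
`F(x,u,∇u) ∈ L_2(Ω)`, and the equation holds against all test functions. The weak gradient `G`
of `u` is determined by `u` almost everywhere in `Ω`. -/
def IsWeakSolution {d : ℕ} (Ω : Set (EuclideanSpace ℝ (Fin d))) (μ : ℝ)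
    (F : EuclideanSpace ℝ (Fin d) → ℝ → EuclideanSpace ℝ (Fin d) → ℝ)
    (u : EuclideanSpace ℝ (Fin d) → ℝ) : Prop :=
  ∃ G : EuclideanSpace ℝ (Fin d) → EuclideanSpace ℝ (Fin d),
    MemH10 Ω u G ∧
    MemLp (fun x => F x (u x) (G x)) 2 (volume.restrict Ω) ∧
    ∀ φ : EuclideanSpace ℝ (Fin d) → ℝ, IsTestFunction Ω φ →
      (∫ x in Ω, inner ℝ (G x) (∇ φ x)) + μ * ∫ x in Ω, u x * φ x
        = ∫ x in Ω, F x (u x) (G x) * φ x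

/-- The right-hand side `t b_σ(x,s,ξ) χ_U(x)` of the truncated problem. -/
def truncRHS {d : ℕ} (f : EuclideanSpace ℝ (Fin d) → ℝ → EuclideanSpace ℝ (Fin d) → ℝ)
    (μ t : ℝ) (U : Set (EuclideanSpace ℝ (Fin d))) (v₀ v₁ : EuclideanSpace ℝ (Fin d) → ℝ)
    (x : EuclideanSpace ℝ (Fin d)) (s : ℝ) (ξ : EuclideanSpace ℝ (Fin d)) : ℝ :=
  U.indicator (fun y => t * bTrunc f μ v₀ v₁ y s ξ) x

/-- The exponent `q** = qd/(d-2q)` for `q < d/2`, and `q** = ∞` for `q > d/2`. -/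
def qStarStar (d : ℕ) (q : ℝ) : ℝ≥0∞ :=
  if q < (d : ℝ) / 2 then ENNReal.ofReal (q * d / (d - 2 * q)) else ∞

end SemilinearDirichlet

end

namespace SemilinearDirichlet

/-! ### Convergence in `L_2` -/

section L2

variable {α F : Type*} [MeasurableSpace α] {μ : Measure α} [NormedAddCommGroup F]

/-! The truncation is harmless: `σ(x,s)` has the sign of `s` and modulus at most `|s|`, so the
coerciveness of `f` together with `μ ≥ 0` and `t ≤ 1` gives, in the weak sense, `-Δ|u| ≤ δ|u| +
L|∇u| + h`, with no trace of `μ`, `t`, `v₀`, `v₁` or `ω` (`truncRHS_sub_mul_le`,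
`isWeakSubsolution_of_isWeakSolution`). Everything after that uses only this inequality.

For a weight `ρ` with primitive `Γ`, testing with the primitive of `ρ²` at `u` and absorbing the
gradient term by Young's inequality bounds `∫|∇Γ(u)|²` by `∫Γ²`, `∫|Γ|ρ|u|` and `∫|Γ|ρ|h|`
(`IsWeakSubsolution.caccioppoli`). Sobolev's inequality turns this into a bound of `‖Γ(u)‖_r²` by
the same integrals (`SobolevBound`), where `r = 2m/(m-2)` and `m = max d 3`. Two choices of `ρ`
finish the proof.

If `q > d/2`, take the indicator of `|s| > a`, so `|Γ(s)| = (|s|-a)₊`. The measures of the sets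
where `|u| > a` then satisfy a superlinear recursion along increasing levels
(`SobolevBound.level_set`), and De Giorgi's iteration shows that they vanish at a level proportional
to `‖u‖_2 + ‖h‖_q` (`SobolevBound.eLpNorm_top_le`).

If `q < d/2`, take the derivative of a truncation of `|s|^k`, with `k` chosen so that Hölder's
inequality closes on `‖Γ(u)‖_r` itself and `rk = q**`. One Moser step suffices: the quadratic terms
are absorbed where `|u|` exceeds a multiple of `‖u‖_2`, a set of small measure, and are controlled
by `‖u‖_2` elsewhere (`SobolevBound.power_le`). The bound does not depend on the truncation, which
is removed by Fatou's lemma (`SobolevBound.eLpNorm_le`). -/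

theorem tendsto_eLpNorm_two_of_dominated {f : ℕ → α → F} {g : α → ℝ}
    (hf : ∀ n, AEStronglyMeasurable (f n) μ) (hg : MemLp g 2 μ)
    (hb : ∀ n, ∀ᵐ x ∂μ, ‖f n x‖ ≤ g x)
    (hl : ∀ᵐ x ∂μ, Tendsto (fun n => f n x) atTop (𝓝 0)) :
    Tendsto (fun n => eLpNorm (f n) 2 μ) atTop (𝓝 0) := by
  have key : Tendsto (fun n => ∫⁻ x, ‖f n x‖ₑ ^ (2 : ℝ) ∂μ) atTop (𝓝 (∫⁻ _, 0 ∂μ)) := by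
    refine tendsto_lintegral_of_dominated_convergence' (fun x => ‖g x‖ₑ ^ (2 : ℝ))
      (fun n => (hf n).enorm.pow_const _) (fun n => ?_) ?_ ?_
    · filter_upwards [hb n] with x hx
      gcongr
      exact enorm_le_iff_norm_le.2 (hx.trans (le_abs_self _))
    · have := lintegral_rpow_enorm_lt_top_of_eLpNorm_lt_top (p := 2) (by simp) (by simp) hg.2
      simpa using this.ne
    · filter_upwards [hl] with x hx
      have h1 : Tendsto (fun n => ‖f n x‖ₑ) atTop (𝓝 0) := by simpa using hx.enorm
      have := (ENNReal.continuous_rpow_const (y := (2 : ℝ))).tendsto 0 |>.comp h1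
      simpa [Function.comp_def] using this
  have := (ENNReal.continuous_rpow_const (y := (1 / 2 : ℝ))).tendsto _ |>.comp key
  simpa [eLpNorm_eq_lintegral_rpow_enorm_toReal, Function.comp_def] using this

theorem exists_seq_tendsto_ae_of_eLpNorm_two {f : ℕ → α → F} {g : α → F}
    (hf : ∀ n, AEStronglyMeasurable (f n) μ) (hg : AEStronglyMeasurable g μ)
    (h : Tendsto (fun n => eLpNorm (f n - g) 2 μ) atTop (𝓝 0)) :
    ∃ ns : ℕ → ℕ, StrictMono ns ∧
      ∀ᵐ x ∂μ, Tendsto (fun i => f (ns i) x) atTop (𝓝 (g x)) :=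
  (tendstoInMeasure_of_tendsto_eLpNorm (by simp) hf hg h).exists_seq_tendsto_ae

theorem tendsto_integral_inner_of_eLpNorm_two [InnerProductSpace ℝ F] {f : ℕ → α → F}
    {g k : α → F} (hf : ∀ n, MemLp (f n) 2 μ) (hg : MemLp g 2 μ) (hk : MemLp k 2 μ)
    (h : Tendsto (fun n => eLpNorm (f n - g) 2 μ) atTop (𝓝 0)) :
    Tendsto (fun n => ∫ x, inner ℝ (k x) (f n x) ∂μ) atTop (𝓝 (∫ x, inner ℝ (k x) (g x) ∂μ)) := by
  have h1 := (Lp.tendsto_Lp_iff_tendsto_eLpNorm'' f hf g hg).2 h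
  have h2 : Tendsto (fun n => inner ℝ (hk.toLp k) ((hf n).toLp (f n))) atTop
      (𝓝 (inner ℝ (hk.toLp k) (hg.toLp g))) := tendsto_const_nhds.inner h1
  have h3 : ∀ (v : α → F) (hv : MemLp v 2 μ),
      inner ℝ (hk.toLp k) (hv.toLp v) = ∫ x, inner ℝ (k x) (v x) ∂μ := by
    intro v hv
    rw [L2.inner_def]
    refine integral_congr_ae ?_
    filter_upwards [hk.coeFn_toLp, hv.coeFn_toLp] with x h1 h2
    rw [h1, h2]
  simpa only [h3] using h2

end L2

/-! ### The space `H^1_0` and the chain rule for primitives -/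

variable {d : ℕ} {Ω : Set (EuclideanSpace ℝ (Fin d))}

/-- `v` and `H` are the `L_2(Ω)`-limits of test functions and of their gradients. -/
structure InH10 (Ω : Set (EuclideanSpace ℝ (Fin d))) (v : EuclideanSpace ℝ (Fin d) → ℝ)
    (H : EuclideanSpace ℝ (Fin d) → EuclideanSpace ℝ (Fin d)) : Prop where
  memLp : MemLp v 2 (volume.restrict Ω)
  memLp_grad : MemLp H 2 (volume.restrict Ω)
  approx : ∀ ε : ℝ≥0∞, 0 < ε → ∃ ψ : EuclideanSpace ℝ (Fin d) → ℝ, IsTestFunction Ω ψ ∧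
    eLpNorm (ψ - v) 2 (volume.restrict Ω) ≤ ε ∧ eLpNorm (∇ ψ - H) 2 (volume.restrict Ω) ≤ ε

theorem gradient_continuous {φ : EuclideanSpace ℝ (Fin d) → ℝ} (h : ContDiff ℝ ∞ φ) :
    Continuous (∇ φ) :=
  (InnerProductSpace.toDual ℝ _).symm.continuous.comp (h.continuous_fderiv (by simp))

theorem IsTestFunction.memLp {φ : EuclideanSpace ℝ (Fin d) → ℝ} (h : IsTestFunction Ω φ) :
    MemLp φ 2 (volume.restrict Ω) :=
  (h.contDiff.continuous.memLp_of_hasCompactSupport h.hasCompactSupport).restrict Ω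

theorem IsTestFunction.memLp_gradient {φ : EuclideanSpace ℝ (Fin d) → ℝ}
    (h : IsTestFunction Ω φ) : MemLp (∇ φ) 2 (volume.restrict Ω) := by
  refine ((gradient_continuous h.contDiff).memLp_of_hasCompactSupport ?_).restrict Ω
  exact (h.hasCompactSupport.fderiv (𝕜 := ℝ)).comp_left
    (g := (InnerProductSpace.toDual ℝ (EuclideanSpace ℝ (Fin d))).symm) (map_zero _)

theorem InH10.exists_seq {v : EuclideanSpace ℝ (Fin d) → ℝ}
    {H : EuclideanSpace ℝ (Fin d) → EuclideanSpace ℝ (Fin d)} (h : InH10 Ω v H) :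
    ∃ ψ : ℕ → EuclideanSpace ℝ (Fin d) → ℝ, (∀ n, IsTestFunction Ω (ψ n)) ∧
      Tendsto (fun n => eLpNorm (ψ n - v) 2 (volume.restrict Ω)) atTop (𝓝 0) ∧
      Tendsto (fun n => eLpNorm (∇ (ψ n) - H) 2 (volume.restrict Ω)) atTop (𝓝 0) ∧
      ∀ᵐ x ∂(volume.restrict Ω), Tendsto (fun n => ψ n x) atTop (𝓝 (v x)) := by
  obtain ⟨e, -, he, hlim⟩ := exists_seq_strictAnti_tendsto' (zero_lt_one (α := ℝ≥0∞))
  choose ψ h1 h2 h3 using fun n => h.approx (e n) (he n).1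
  have h2' := tendsto_of_tendsto_of_tendsto_of_le_of_le tendsto_const_nhds hlim
    (fun _ => zero_le) h2
  have h3' := tendsto_of_tendsto_of_tendsto_of_le_of_le tendsto_const_nhds hlim
    (fun _ => zero_le) h3
  obtain ⟨ns, hns, hae⟩ := exists_seq_tendsto_ae_of_eLpNorm_two
    (fun n => (h1 n).memLp.1) h.memLp.1 h2'
  exact ⟨fun i => ψ (ns i), fun i => h1 _, h2'.comp hns.tendsto_atTop,
    h3'.comp hns.tendsto_atTop, hae⟩

theorem InH10.of_tendsto {v : EuclideanSpace ℝ (Fin d) → ℝ}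
    {H : EuclideanSpace ℝ (Fin d) → EuclideanSpace ℝ (Fin d)}
    {vs : ℕ → EuclideanSpace ℝ (Fin d) → ℝ}
    {Hs : ℕ → EuclideanSpace ℝ (Fin d) → EuclideanSpace ℝ (Fin d)}
    (hs : ∀ n, InH10 Ω (vs n) (Hs n)) (hv : MemLp v 2 (volume.restrict Ω))
    (hH : MemLp H 2 (volume.restrict Ω))
    (h1 : Tendsto (fun n => eLpNorm (vs n - v) 2 (volume.restrict Ω)) atTop (𝓝 0))
    (h2 : Tendsto (fun n => eLpNorm (Hs n - H) 2 (volume.restrict Ω)) atTop (𝓝 0)) :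
    InH10 Ω v H := by
  refine ⟨hv, hH, fun ε hε => ?_⟩
  have hε2 : 0 < ε / 2 := ENNReal.half_pos hε.ne'
  obtain ⟨n, hn1, hn2⟩ := ((h1.eventually_le_const hε2).and (h2.eventually_le_const hε2)).exists
  obtain ⟨ψ, hψ, a1, a2⟩ := (hs n).approx _ hε2
  refine ⟨ψ, hψ, ?_, ?_⟩
  · calc eLpNorm (ψ - v) 2 (volume.restrict Ω)
        = eLpNorm ((ψ - vs n) + (vs n - v)) 2 (volume.restrict Ω) := by simp
      _ ≤ _ := eLpNorm_add_le (hψ.memLp.1.sub (hs n).memLp.1) ((hs n).memLp.1.sub hv.1)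
          (by norm_num)
      _ ≤ ε / 2 + ε / 2 := add_le_add a1 hn1
      _ = ε := ENNReal.add_halves ε
  · calc eLpNorm (∇ ψ - H) 2 (volume.restrict Ω)
        = eLpNorm ((∇ ψ - Hs n) + (Hs n - H)) 2 (volume.restrict Ω) := by simp
      _ ≤ _ := eLpNorm_add_le (hψ.memLp_gradient.1.sub (hs n).memLp_grad.1)
          ((hs n).memLp_grad.1.sub hH.1) (by norm_num)
      _ ≤ ε / 2 + ε / 2 := add_le_add a2 hn2
      _ = ε := ENNReal.add_halves ε

theorem MemH10.inH10 {v : EuclideanSpace ℝ (Fin d) → ℝ}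
    {H : EuclideanSpace ℝ (Fin d) → EuclideanSpace ℝ (Fin d)} (h : MemH10 Ω v H) :
    InH10 Ω v H := by
  refine ⟨h.memH1.memLp, h.memH1.memLp_grad, fun ε hε => ?_⟩
  obtain ⟨φ, h1, h2, h3⟩ := h.approx
  obtain ⟨n, hn1, hn2⟩ := ((h2.eventually_le_const hε).and (h3.eventually_le_const hε)).exists
  exact ⟨φ n, h1 n, hn1, hn2⟩

theorem IsTestFunction.inH10 {φ : EuclideanSpace ℝ (Fin d) → ℝ} (h : IsTestFunction Ω φ) :
    InH10 Ω φ (∇ φ) :=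
  ⟨h.memLp, h.memLp_gradient, fun ε _ => ⟨φ, h, by simp, by simp⟩⟩

/-- The identity `∫ ⟨G, ∇φ⟩ = ∫ g φ` extends from test functions to their `H^1`-limits. -/
theorem InH10.weak_formulation {v g : EuclideanSpace ℝ (Fin d) → ℝ}
    {H G : EuclideanSpace ℝ (Fin d) → EuclideanSpace ℝ (Fin d)} (h : InH10 Ω v H)
    (hG : MemLp G 2 (volume.restrict Ω)) (hg : MemLp g 2 (volume.restrict Ω))
    (hw : ∀ φ, IsTestFunction Ω φ → ∫ x in Ω, inner ℝ (G x) (∇ φ x) = ∫ x in Ω, g x * φ x) :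
    ∫ x in Ω, inner ℝ (G x) (H x) = ∫ x in Ω, g x * v x := by
  obtain ⟨ψ, h1, h2, h3, -⟩ := h.exists_seq
  have a1 := tendsto_integral_inner_of_eLpNorm_two (fun n => (h1 n).memLp_gradient)
    h.memLp_grad hG h3
  have a2 := tendsto_integral_inner_of_eLpNorm_two (fun n => (h1 n).memLp) h.memLp hg h2
  simp only [RCLike.inner_apply, conj_trivial] at a2
  simp only [mul_comm _ (g _)] at a2
  refine tendsto_nhds_unique a1 ?_
  simpa only [hw _ (h1 _)] using a2

theorem IsTestFunction.comp {φ : EuclideanSpace ℝ (Fin d) → ℝ} (h : IsTestFunction Ω φ)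
    {η : ℝ → ℝ} (hη : ContDiff ℝ ∞ η) (h0 : η 0 = 0) :
    IsTestFunction Ω (fun x => η (φ x)) ∧
      ∀ x, ∇ (fun x => η (φ x)) x = deriv η (φ x) • ∇ φ x := by
  refine ⟨⟨hη.comp h.contDiff, h.hasCompactSupport.comp_left h0,
    (tsupport_comp_subset h0 φ).trans h.tsupport_subset⟩, fun x => ?_⟩
  have h1 : HasDerivAt η (deriv η (φ x)) (φ x) :=
    (hη.differentiable (by simp)).differentiableAt.hasDerivAt
  have h2 : HasFDerivAt φ (fderiv ℝ φ x) x :=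
    (h.contDiff.differentiable (by simp)).differentiableAt.hasFDerivAt
  have h3 := (h1.comp_hasFDerivAt x h2).fderiv
  simp only [gradient, Function.comp_def] at h3 ⊢
  rw [h3, map_smul]

/-- Composition preserves test functions, so it remains to pass to the limit. The difference of
gradients is `η'(ψ)(∇ψ - G) + (η'(ψ) - η'(u))G`: the first term is small because `η'` is bounded,
the second by dominated convergence along an almost everywhere convergent sequence. -/
theorem InH10.comp_contDiff {u : EuclideanSpace ℝ (Fin d) → ℝ}
    {G : EuclideanSpace ℝ (Fin d) → EuclideanSpace ℝ (Fin d)} (h : InH10 Ω u G)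
    {η : ℝ → ℝ} (hη : ContDiff ℝ ∞ η) (h0 : η 0 = 0) {B : ℝ} (hB : ∀ s, |deriv η s| ≤ B) :
    InH10 Ω (fun x => η (u x)) (fun x => deriv η (u x) • G x) := by
  obtain ⟨ψ, h1, h2, h3, h4⟩ := h.exists_seq
  have hB0 : 0 ≤ B := (abs_nonneg _).trans (hB 0)
  have hlip : ∀ s t, |η s - η t| ≤ B * |s - t| := fun s t => by
    simpa using Convex.norm_image_sub_le_of_norm_deriv_le (s := Set.univ) (f := η) (C := B)
      (fun x _ => (hη.differentiable (by simp)).differentiableAt) (fun x _ => by simpa using hB x)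
      convex_univ (Set.mem_univ t) (Set.mem_univ s)
  have hc : Continuous (deriv η) := hη.continuous_deriv (by simp)
  have hmu : AEStronglyMeasurable (fun x => deriv η (u x)) (volume.restrict Ω) :=
    hc.comp_aestronglyMeasurable h.memLp.1
  have hmψ : ∀ n, AEStronglyMeasurable (fun x => deriv η (ψ n x)) (volume.restrict Ω) :=
    fun n => hc.comp_aestronglyMeasurable (h1 n).memLp.1
  have hv : MemLp (fun x => η (u x)) 2 (volume.restrict Ω) :=
    h.memLp.of_le_mul (c := B) (hη.continuous.comp_aestronglyMeasurable h.memLp.1)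
      (.of_forall fun x => by simpa [h0] using hlip (u x) 0)
  have hH : MemLp (fun x => deriv η (u x) • G x) 2 (volume.restrict Ω) :=
    h.memLp_grad.of_le_mul (c := B) (hmu.smul h.memLp_grad.1)
      (.of_forall fun x => by rw [norm_smul]; gcongr; exact hB _)
  refine InH10.of_tendsto (fun n => ((h1 n).comp hη h0).1.inH10) hv hH ?_ ?_
  · refine tendsto_of_tendsto_of_tendsto_of_le_of_le tendsto_const_nhds
      (g := fun _ => 0) (h := fun n => ENNReal.ofReal B * eLpNorm (ψ n - u) 2 (volume.restrict Ω))
      ?_ (fun _ => zero_le) (fun n => ?_)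
    · simpa using ENNReal.Tendsto.const_mul (a := ENNReal.ofReal B) h2 (.inr ENNReal.ofReal_ne_top)
    · exact eLpNorm_le_mul_eLpNorm_of_ae_le_mul (.of_forall fun x => hlip _ _) 2
  · have e1 : Tendsto (fun n => ENNReal.ofReal B * eLpNorm (∇ (ψ n) - G) 2 (volume.restrict Ω)
        + eLpNorm (fun x => (deriv η (ψ n x) - deriv η (u x)) • G x) 2 (volume.restrict Ω))
        atTop (𝓝 0) := by
      have a1 : Tendsto (fun n => ENNReal.ofReal B * eLpNorm (∇ (ψ n) - G) 2 (volume.restrict Ω))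
          atTop (𝓝 0) := by
        simpa using
          ENNReal.Tendsto.const_mul (a := ENNReal.ofReal B) h3 (.inr ENNReal.ofReal_ne_top)
      have a2 := tendsto_eLpNorm_two_of_dominated (μ := volume.restrict Ω)
        (f := fun n x => (deriv η (ψ n x) - deriv η (u x)) • G x) (g := fun x => 2 * B * ‖G x‖)
        (fun n => ((hmψ n).sub hmu).smul h.memLp_grad.1) (h.memLp_grad.norm.const_mul (2 * B))
        (fun n => .of_forall fun x => by
          rw [norm_smul]
          gcongr
          calc ‖deriv η (ψ n x) - deriv η (u x)‖ ≤ |deriv η (ψ n x)| + |deriv η (u x)| :=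
                norm_sub_le _ _
            _ ≤ 2 * B := by linarith [hB (ψ n x), hB (u x)])
        (by
          filter_upwards [h4] with x hx
          have := (((hc.tendsto _).comp hx).sub_const (deriv η (u x))).smul_const (G x)
          simpa using this)
      simpa using a1.add a2
    refine tendsto_of_tendsto_of_tendsto_of_le_of_le tendsto_const_nhds e1
      (fun _ => zero_le) (fun n => ?_)
    have e2 : (∇ (fun x => η (ψ n x)) - fun x => deriv η (u x) • G x) =
        (fun x => deriv η (ψ n x) • (∇ (ψ n) x - G x)) +
          fun x => (deriv η (ψ n x) - deriv η (u x)) • G x := by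
      funext x
      simp only [Pi.sub_apply, Pi.add_apply, ((h1 n).comp hη h0).2 x, smul_sub, sub_smul]
      abel
    rw [e2]
    refine (eLpNorm_add_le ((hmψ n).smul ((h1 n).memLp_gradient.1.sub h.memLp_grad.1))
      (((hmψ n).sub hmu).smul h.memLp_grad.1) (by norm_num)).trans ?_
    gcongr
    · exact eLpNorm_le_mul_eLpNorm_of_ae_le_mul (.of_forall fun x =>
        (norm_smul_le (deriv η (ψ n x)) (∇ (ψ n) x - G x)).trans
          (mul_le_mul_of_nonneg_right (hB _) (norm_nonneg _))) 2
    · exact le_rfl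

/-- The primitive `s ↦ ∫_0^s ρ`. -/
noncomputable def primitive (ρ : ℝ → ℝ) (s : ℝ) : ℝ := ∫ t in (0 : ℝ)..s, ρ t

/-- Pointwise limits of uniformly bounded sequences of continuous functions. -/
def BoundedLimit (ρ : ℝ → ℝ) : Prop :=
  ∃ (ρs : ℕ → ℝ → ℝ) (B : ℝ), (∀ n, Continuous (ρs n)) ∧ (∀ n s, |ρs n s| ≤ B) ∧
    ∀ s, Tendsto (fun n => ρs n s) atTop (𝓝 (ρ s))

theorem BoundedLimit.sq {ρ : ℝ → ℝ} (h : BoundedLimit ρ) : BoundedLimit (fun s => ρ s ^ 2) := by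
  obtain ⟨ρs, B, h1, h2, h3⟩ := h
  refine ⟨fun n s => ρs n s ^ 2, B ^ 2, fun n => (h1 n).pow 2, fun n s => ?_, fun s => (h3 s).pow 2⟩
  rw [abs_pow]
  exact pow_le_pow_left₀ (abs_nonneg _) (h2 n s) 2

theorem BoundedLimit.measurable {ρ : ℝ → ℝ} (h : BoundedLimit ρ) : Measurable ρ := by
  obtain ⟨ρs, B, h1, h2, h3⟩ := h
  exact measurable_of_tendsto_metrizable (fun n => (h1 n).measurable) (tendsto_pi_nhds.2 h3)

theorem BoundedLimit.exists_bound {ρ : ℝ → ℝ} (h : BoundedLimit ρ) : ∃ B, ∀ s, |ρ s| ≤ B := by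
  obtain ⟨ρs, B, h1, h2, h3⟩ := h
  exact ⟨B, fun s => le_of_tendsto' (h3 s).abs (fun n => h2 n s)⟩

theorem intervalIntegrable_of_bounded {ρ : ℝ → ℝ} (hm : Measurable ρ) {B : ℝ}
    (hB : ∀ s, |ρ s| ≤ B) (a b : ℝ) : IntervalIntegrable ρ volume a b :=
  (intervalIntegrable_const (c := B)).mono_fun hm.aestronglyMeasurable
    (.of_forall fun s => (hB s).trans (le_abs_self B))

theorem abs_primitive_sub_le {ρ : ℝ → ℝ} (hm : Measurable ρ) {B : ℝ} (hB : ∀ s, |ρ s| ≤ B)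
    (s t : ℝ) : |primitive ρ s - primitive ρ t| ≤ B * |s - t| := by
  unfold primitive
  rw [intervalIntegral.integral_interval_sub_left (intervalIntegrable_of_bounded hm hB _ _)
    (intervalIntegrable_of_bounded hm hB _ _)]
  exact intervalIntegral.norm_integral_le_of_norm_le_const fun x _ =>
    (Real.norm_eq_abs _).trans_le (hB x)

theorem abs_primitive_le {ρ : ℝ → ℝ} (hm : Measurable ρ) {B : ℝ} (hB : ∀ s, |ρ s| ≤ B)
    (s : ℝ) : |primitive ρ s| ≤ B * |s| := by
  simpa [primitive] using abs_primitive_sub_le hm hB s 0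

theorem continuous_primitive {ρ : ℝ → ℝ} (hm : Measurable ρ) {B : ℝ} (hB : ∀ s, |ρ s| ≤ B) :
    Continuous (primitive ρ) :=
  (LipschitzWith.of_dist_le_mul (K := ⟨B, (abs_nonneg _).trans (hB 0)⟩)
    fun s t => abs_primitive_sub_le hm hB s t).continuous

/-- Dominated convergence with majorants `2B|u|` and `2B|G|`. Convergence of the weights is required
at every `s`, not just almost every `s`, since `u` may take a single value on a set of positive
measure. -/
theorem InH10.primitive_of_tendsto {u : EuclideanSpace ℝ (Fin d) → ℝ}
    {G : EuclideanSpace ℝ (Fin d) → EuclideanSpace ℝ (Fin d)} (h : InH10 Ω u G)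
    {ρ : ℝ → ℝ} {ρs : ℕ → ℝ → ℝ} {B : ℝ} (hm : ∀ n, Measurable (ρs n))
    (hB : ∀ n s, |ρs n s| ≤ B) (hl : ∀ s, Tendsto (fun n => ρs n s) atTop (𝓝 (ρ s)))
    (hs : ∀ n, InH10 Ω (fun x => primitive (ρs n) (u x)) (fun x => ρs n (u x) • G x)) :
    InH10 Ω (fun x => primitive ρ (u x)) (fun x => ρ (u x) • G x) := by
  have hmρ : Measurable ρ := measurable_of_tendsto_metrizable hm (tendsto_pi_nhds.2 hl)
  have hBρ : ∀ s, |ρ s| ≤ B := fun s => le_of_tendsto' (hl s).abs (fun n => hB n s)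
  have hB0 : 0 ≤ B := (abs_nonneg _).trans (hBρ 0)
  have hmu : AEStronglyMeasurable (fun x => ρ (u x)) (volume.restrict Ω) :=
    (hmρ.comp_aemeasurable h.memLp.1.aemeasurable).aestronglyMeasurable
  have hv : MemLp (fun x => primitive ρ (u x)) 2 (volume.restrict Ω) :=
    h.memLp.of_le_mul (c := B) ((continuous_primitive hmρ hBρ).comp_aestronglyMeasurable h.memLp.1)
      (.of_forall fun x => abs_primitive_le hmρ hBρ _)
  have hH : MemLp (fun x => ρ (u x) • G x) 2 (volume.restrict Ω) :=
    h.memLp_grad.of_le_mul (c := B) (hmu.smul h.memLp_grad.1)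
      (.of_forall fun x => by rw [norm_smul]; gcongr; exact hBρ _)
  refine InH10.of_tendsto hs hv hH ?_ ?_
  · refine tendsto_eLpNorm_two_of_dominated (g := fun x => 2 * B * |u x|)
      (fun n => (hs n).memLp.1.sub hv.1) (h.memLp.norm.const_mul (2 * B))
      (fun n => .of_forall fun x => ?_) (.of_forall fun x => ?_)
    · calc ‖primitive (ρs n) (u x) - primitive ρ (u x)‖
          ≤ |primitive (ρs n) (u x)| + |primitive ρ (u x)| := norm_sub_le _ _
        _ ≤ B * |u x| + B * |u x| :=
          add_le_add (abs_primitive_le (hm n) (hB n) _) (abs_primitive_le hmρ hBρ _)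
        _ = 2 * B * |u x| := by ring
    · have : Tendsto (fun n => primitive (ρs n) (u x)) atTop (𝓝 (primitive ρ (u x))) :=
        intervalIntegral.tendsto_integral_filter_of_dominated_convergence (fun _ => B)
          (.of_forall fun n => (hm n).aestronglyMeasurable)
          (.of_forall fun n => .of_forall fun s _ => hB n s) intervalIntegrable_const
          (.of_forall fun s _ => hl s)
      simpa using this.sub_const (primitive ρ (u x))
  · refine tendsto_eLpNorm_two_of_dominated (g := fun x => 2 * B * ‖G x‖)
      (fun n => (hs n).memLp_grad.1.sub hH.1) (h.memLp_grad.norm.const_mul (2 * B))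
      (fun n => .of_forall fun x => ?_) (.of_forall fun x => ?_)
    · calc ‖ρs n (u x) • G x - ρ (u x) • G x‖
          ≤ ‖ρs n (u x) • G x‖ + ‖ρ (u x) • G x‖ := norm_sub_le _ _
        _ ≤ B * ‖G x‖ + B * ‖G x‖ := by
          rw [norm_smul, norm_smul]
          gcongr
          exacts [hB _ _, hBρ _]
        _ = 2 * B * ‖G x‖ := by ring
    · simpa using ((hl (u x)).smul_const (G x)).sub_const (ρ (u x) • G x)

theorem InH10.primitive_of_contDiff {u : EuclideanSpace ℝ (Fin d) → ℝ}
    {G : EuclideanSpace ℝ (Fin d) → EuclideanSpace ℝ (Fin d)} (h : InH10 Ω u G)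
    {ρ : ℝ → ℝ} (hρ : ContDiff ℝ ∞ ρ) {B : ℝ} (hB : ∀ s, |ρ s| ≤ B) :
    InH10 Ω (fun x => primitive ρ (u x)) (fun x => ρ (u x) • G x) := by
  have hd : ∀ s, HasDerivAt (primitive ρ) (ρ s) s := fun s =>
    (hρ.continuous.integral_hasStrictDerivAt 0 s).hasDerivAt
  have hd' : deriv (primitive ρ) = ρ := funext fun s => (hd s).deriv
  have hc : ContDiff ℝ ∞ (primitive ρ) := by
    rw [contDiff_infty_iff_deriv]
    exact ⟨fun s => (hd s).differentiableAt, by rwa [hd']⟩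
  have := h.comp_contDiff hc (by simp [primitive]) (B := B) (by rwa [hd'])
  rwa [hd'] at this

/-- The limit lemma is used twice: from smooth to continuous weights by uniform approximation, then
from continuous weights to their bounded pointwise limits. The second passage admits jumps, which
the level-set argument needs. -/
theorem InH10.primitive {u : EuclideanSpace ℝ (Fin d) → ℝ}
    {G : EuclideanSpace ℝ (Fin d) → EuclideanSpace ℝ (Fin d)} (h : InH10 Ω u G)
    {ρ : ℝ → ℝ} (hρ : BoundedLimit ρ) :
    InH10 Ω (fun x => primitive ρ (u x)) (fun x => ρ (u x) • G x) := by
  obtain ⟨ρs, B, h1, h2, h3⟩ := hρ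
  refine h.primitive_of_tendsto (fun n => (h1 n).measurable) h2 h3 fun n => ?_
  have hpos : ∀ k : ℕ, (0 : ℝ) < 1 / ((k : ℝ) + 1) := fun k => Nat.one_div_pos_of_nat
  choose τ hτ1 hτ2 _ using fun k : ℕ =>
    (h1 n).exists_contDiff_approx ⊤ (continuous_const (y := 1 / ((k : ℝ) + 1)))
      (fun _ => hpos k)
  have hle : ∀ k s, |τ k s| ≤ B + 1 := fun k s => by
    have a1 : |τ k s - ρs n s| < 1 / ((k : ℝ) + 1) := hτ2 k s
    have a2 : 1 / ((k : ℝ) + 1) ≤ 1 := by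
      rw [div_le_one (by positivity)]; linarith [(Nat.cast_nonneg k : (0 : ℝ) ≤ k)]
    have a3 := abs_sub_abs_le_abs_sub (τ k s) (ρs n s)
    linarith [h2 n s]
  refine h.primitive_of_tendsto (fun k => (hτ1 k).continuous.measurable) hle (fun s => ?_)
    (fun k => h.primitive_of_contDiff (hτ1 k) (hle k))
  rw [tendsto_iff_dist_tendsto_zero]
  exact squeeze_zero (fun _ => dist_nonneg) (fun k => (hτ2 k s).le)
    tendsto_one_div_add_atTop_nhds_zero_nat

/-! ### Sobolev's inequality in every dimension -/

theorem eLpNorm_prod_mul {α β : Type*} [MeasurableSpace α] [MeasurableSpace β] {μ : Measure α}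
    {ν : Measure β} [SFinite ν] {a : α → ℝ} {b : β → ℝ} (ha : AEStronglyMeasurable a μ)
    (hb : AEStronglyMeasurable b ν) {p : ℝ≥0∞} (hp0 : p ≠ 0) (hp : p ≠ ⊤) :
    eLpNorm (fun z : α × β => a z.1 * b z.2) p (μ.prod ν) = eLpNorm a p μ * eLpNorm b p ν := by
  have hp' : 0 ≤ p.toReal := ENNReal.toReal_nonneg
  simp only [eLpNorm_eq_lintegral_rpow_enorm_toReal hp0 hp, enorm_mul,
    ENNReal.mul_rpow_of_nonneg _ _ hp']
  rw [lintegral_prod_mul (ha.enorm.pow_const _) (hb.enorm.pow_const _),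
    ENNReal.mul_rpow_of_nonneg _ _ (by positivity)]

/-- The Sobolev exponent `2m/(m-2)` with `m = max d 3`. -/
noncomputable def sobolevExponent (d : ℕ) : ℝ :=
  2 * ((max d 3 : ℕ) : ℝ) / (((max d 3 : ℕ) : ℝ) - 2)

theorem inv_sobolevExponent (d : ℕ) :
    (sobolevExponent d)⁻¹ = 2⁻¹ - (((max d 3 : ℕ) : ℝ))⁻¹ := by
  have h : (3 : ℝ) ≤ ((max d 3 : ℕ) : ℝ) := by exact_mod_cast le_max_right d 3
  unfold sobolevExponent
  have h1 : ((max d 3 : ℕ) : ℝ) ≠ 0 := by linarith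
  field_simp

theorem two_lt_sobolevExponent (d : ℕ) : 2 < sobolevExponent d := by
  have h : (3 : ℝ) ≤ ((max d 3 : ℕ) : ℝ) := by exact_mod_cast le_max_right d 3
  unfold sobolevExponent
  rw [lt_div_iff₀ (by linarith)]
  linarith

/-- The Gagliardo-Nirenberg-Sobolev inequality with exponent `2` needs dimension greater than `2`.
Low dimensions are lifted to `m = max d 3` by multiplying `φ` with a fixed bump function `χ` of the
`m - d` additional variables; the norms of `χ` go into the constant, and the `L_2`-norm of `φ`
appears through the derivative of `χ`. -/
theorem sobolev_of_contDiff (d : ℕ) : ∃ C : ℝ, 0 < C ∧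
    ∀ φ : EuclideanSpace ℝ (Fin d) → ℝ, ContDiff ℝ 1 φ → HasCompactSupport φ →
      eLpNorm φ (ENNReal.ofReal (sobolevExponent d)) volume ≤
        ENNReal.ofReal C * (eLpNorm φ 2 volume + eLpNorm (fderiv ℝ φ) 2 volume) := by
  set m := max d 3 with hm
  set r := sobolevExponent d with hr
  have hr2 : 2 < r := two_lt_sobolevExponent d
  let χ : ContDiffBump (0 : EuclideanSpace ℝ (Fin (m - d))) := default
  have hχc : ContDiff ℝ 1 χ := χ.contDiff
  have hχs : HasCompactSupport χ := χ.hasCompactSupport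
  have hχ' : Continuous (fderiv ℝ χ) := hχc.continuous_fderiv one_ne_zero
  have hrt : ENNReal.ofReal r ≠ ⊤ := ENNReal.ofReal_ne_top
  have hr0 : ENNReal.ofReal r ≠ 0 := by simp; linarith
  set N := eLpNorm χ (ENNReal.ofReal r) volume with hN
  have hNt : N ≠ ⊤ := (hχc.continuous.memLp_of_hasCompactSupport hχs).2.ne
  have hN0 : N ≠ 0 := by
    rw [hN, Ne, eLpNorm_eq_zero_iff hχc.continuous.aestronglyMeasurable hr0]
    intro h0
    have := (hχc.continuous.ae_eq_iff_eq volume (continuous_const (y := (0 : ℝ)))).1 h0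
    have h1 : χ 0 = 1 := χ.one_of_mem_closedBall (by simpa using χ.rIn_pos.le)
    rw [this] at h1
    exact zero_ne_one h1
  have hA := (hχc.continuous.memLp_of_hasCompactSupport (p := 2) (μ := volume) hχs).2.ne
  have hB := (hχ'.memLp_of_hasCompactSupport (p := 2) (μ := volume) (hχs.fderiv (𝕜 := ℝ))).2.ne
  set A := eLpNorm χ 2 volume
  set B := eLpNorm (fderiv ℝ χ) 2 volume
  set S : NNReal := SNormLESNormFDerivOfEqConst ℝ ((volume : Measure (EuclideanSpace ℝ (Fin d))).prod
    (volume : Measure (EuclideanSpace ℝ (Fin (m - d))))) (2 : NNReal) with hS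
  have hD : N⁻¹ * (S * (A + B)) ≠ ⊤ :=
    ENNReal.mul_ne_top (ENNReal.inv_ne_top.2 hN0)
      (ENNReal.mul_ne_top ENNReal.coe_ne_top (ENNReal.add_ne_top.2 ⟨hA, hB⟩))
  refine ⟨(N⁻¹ * (S * (A + B))).toReal + 1, by positivity, fun φ hφ hφs => ?_⟩
  set Φ : EuclideanSpace ℝ (Fin d) × EuclideanSpace ℝ (Fin (m - d)) → ℝ :=
    fun z => φ z.1 * χ z.2 with hΦ
  have hφ' : Continuous (fderiv ℝ φ) := hφ.continuous_fderiv one_ne_zero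
  have hΦc : ContDiff ℝ 1 Φ := (hφ.comp contDiff_fst).mul (hχc.comp contDiff_snd)
  have hΦs : HasCompactSupport Φ := by
    refine HasCompactSupport.intro (hφs.prod hχs) fun z hz => ?_
    by_contra hne
    exact hz ⟨subset_tsupport _ (left_ne_zero_of_mul hne),
      subset_tsupport _ (right_ne_zero_of_mul hne)⟩
  have hdim : Module.finrank ℝ (EuclideanSpace ℝ (Fin d) × EuclideanSpace ℝ (Fin (m - d))) = m := by
    simp [hm]
  have key := eLpNorm_le_eLpNorm_fderiv_of_eq ((volume : Measure (EuclideanSpace ℝ (Fin d))).prod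
    (volume : Measure (EuclideanSpace ℝ (Fin (m - d))))) hΦc hΦs (p := 2)
    (p' := r.toNNReal) (by norm_num) (by rw [hdim]; omega)
    (by
      rw [hdim, Real.coe_toNNReal _ (by linarith), hr, inv_sobolevExponent]
      norm_num [hm])
  have hfd : ∀ z, ‖fderiv ℝ Φ z‖ ≤ ‖φ z.1‖ * ‖fderiv ℝ χ z.2‖ + ‖fderiv ℝ φ z.1‖ * ‖χ z.2‖ := by
    intro z
    have h1 := ((hφ.differentiable one_ne_zero) z.1).hasFDerivAt.comp z
      (hasFDerivAt_fst (𝕜 := ℝ) (E := EuclideanSpace ℝ (Fin d))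
        (F := EuclideanSpace ℝ (Fin (m - d))) (p := z))
    have h2 := ((hχc.differentiable one_ne_zero) z.2).hasFDerivAt.comp z
      (hasFDerivAt_snd (𝕜 := ℝ) (E := EuclideanSpace ℝ (Fin d))
        (F := EuclideanSpace ℝ (Fin (m - d))) (p := z))
    have h3 := (h1.mul h2).fderiv
    have h4 : fderiv ℝ Φ z = _ := h3
    rw [h4]
    refine (norm_add_le _ _).trans (add_le_add ?_ ?_)
    · rw [norm_smul]
      refine mul_le_mul_of_nonneg_left ?_ (norm_nonneg _)
      exact (ContinuousLinearMap.opNorm_comp_le _ _).trans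
        (mul_le_of_le_one_right (norm_nonneg _) (ContinuousLinearMap.norm_snd_le _ _ _))
    · rw [norm_smul, mul_comm]
      refine mul_le_mul_of_nonneg_right ?_ (norm_nonneg _)
      exact (ContinuousLinearMap.opNorm_comp_le _ _).trans
        (mul_le_of_le_one_right (norm_nonneg _) (ContinuousLinearMap.norm_fst_le _ _ _))
  have hfd2 : eLpNorm (fderiv ℝ Φ) 2 (volume.prod volume) ≤
      eLpNorm φ 2 volume * B + eLpNorm (fderiv ℝ φ) 2 volume * A := by
    refine (eLpNorm_mono_real hfd).trans ?_
    refine (eLpNorm_add_le (Continuous.aestronglyMeasurable (by fun_prop))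
      (Continuous.aestronglyMeasurable ?_) (by norm_num)).trans ?_
    · have := hχc.continuous
      fun_prop
    rw [eLpNorm_prod_mul (a := fun x => ‖φ x‖) (b := fun x => ‖fderiv ℝ χ x‖)
      hφ.continuous.norm.aestronglyMeasurable hχ'.norm.aestronglyMeasurable (by simp) (by simp),
      eLpNorm_prod_mul (a := fun x => ‖fderiv ℝ φ x‖) (b := fun x => ‖χ x‖)
      hφ'.norm.aestronglyMeasurable hχc.continuous.norm.aestronglyMeasurable (by simp) (by simp)]
    simp only [eLpNorm_norm]
    exact le_rfl
  have hL : eLpNorm Φ (r.toNNReal : ℝ≥0∞) (volume.prod volume) =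
      eLpNorm φ (ENNReal.ofReal r) volume * N := by
    exact eLpNorm_prod_mul hφ.continuous.aestronglyMeasurable
      hχc.continuous.aestronglyMeasurable hr0 hrt
  rw [hL, ← hS] at key
  calc eLpNorm φ (ENNReal.ofReal r) volume
      = N⁻¹ * (eLpNorm φ (ENNReal.ofReal r) volume * N) := by
        rw [mul_comm _ N, ← mul_assoc, ENNReal.inv_mul_cancel hN0 hNt, one_mul]
    _ ≤ N⁻¹ * (S * (eLpNorm φ 2 volume * B + eLpNorm (fderiv ℝ φ) 2 volume * A)) := by
        gcongr N⁻¹ * ?_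
        refine key.trans ?_
        gcongr S * ?_
        exact hfd2
    _ ≤ N⁻¹ * (S * (eLpNorm φ 2 volume * (A + B) + eLpNorm (fderiv ℝ φ) 2 volume * (A + B))) := by
        gcongr
        exacts [le_add_self, le_self_add]
    _ = (N⁻¹ * (S * (A + B))) * (eLpNorm φ 2 volume + eLpNorm (fderiv ℝ φ) 2 volume) := by ring
    _ ≤ _ := by
        gcongr
        rw [← ENNReal.ofReal_toReal hD]
        exact ENNReal.ofReal_le_ofReal (by simp)

theorem InH10.sobolev (d : ℕ) : ∃ C : ℝ, 0 < C ∧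
    ∀ (Ω : Set (EuclideanSpace ℝ (Fin d))) (v : EuclideanSpace ℝ (Fin d) → ℝ)
      (H : EuclideanSpace ℝ (Fin d) → EuclideanSpace ℝ (Fin d)), InH10 Ω v H →
      eLpNorm v (ENNReal.ofReal (sobolevExponent d)) (volume.restrict Ω) ≤
        ENNReal.ofReal C *
          (eLpNorm v 2 (volume.restrict Ω) + eLpNorm H 2 (volume.restrict Ω)) := by
  obtain ⟨C, hC, hS⟩ := sobolev_of_contDiff d
  refine ⟨C, hC, fun Ω v H h => ?_⟩
  obtain ⟨ψ, h1, h2, h3, h4⟩ := h.exists_seq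
  have hψ : ∀ n, eLpNorm (ψ n) (ENNReal.ofReal (sobolevExponent d)) (volume.restrict Ω) ≤
      ENNReal.ofReal C *
        ((eLpNorm v 2 (volume.restrict Ω) + eLpNorm (ψ n - v) 2 (volume.restrict Ω)) +
        (eLpNorm H 2 (volume.restrict Ω) + eLpNorm (∇ (ψ n) - H) 2 (volume.restrict Ω))) := by
    intro n
    have ht := (h1 n).tsupport_subset
    have a0 := (eLpNorm_mono_measure (ψ n) (Measure.restrict_le_self (s := Ω))).trans
      (hS (ψ n) ((h1 n).contDiff.of_le (by simp)) (h1 n).hasCompactSupport)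
    refine a0.trans ?_
    gcongr
    · rw [← eLpNorm_restrict_eq_of_support_subset (f := ψ n) ((subset_tsupport _).trans ht)]
      calc eLpNorm (ψ n) 2 (volume.restrict Ω)
          = eLpNorm (v + (ψ n - v)) 2 (volume.restrict Ω) := by simp
        _ ≤ _ := eLpNorm_add_le h.memLp.1 ((h1 n).memLp.1.sub h.memLp.1) (by norm_num)
    · rw [← eLpNorm_restrict_eq_of_support_subset (f := fderiv ℝ (ψ n))
        ((support_fderiv_subset ℝ).trans ht)]
      calc eLpNorm (fderiv ℝ (ψ n)) 2 (volume.restrict Ω)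
          = eLpNorm (∇ (ψ n)) 2 (volume.restrict Ω) := by
            refine eLpNorm_congr_norm_ae (.of_forall fun x => ?_)
            simp [gradient]
        _ = eLpNorm (H + (∇ (ψ n) - H)) 2 (volume.restrict Ω) := by simp
        _ ≤ _ := eLpNorm_add_le h.memLp_grad.1
          ((h1 n).memLp_gradient.1.sub h.memLp_grad.1) (by norm_num)
  have hlim : Tendsto (fun n => ENNReal.ofReal C *
        ((eLpNorm v 2 (volume.restrict Ω) + eLpNorm (ψ n - v) 2 (volume.restrict Ω)) +
        (eLpNorm H 2 (volume.restrict Ω) + eLpNorm (∇ (ψ n) - H) 2 (volume.restrict Ω)))) atTop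
      (𝓝 (ENNReal.ofReal C *
        ((eLpNorm v 2 (volume.restrict Ω) + 0) + (eLpNorm H 2 (volume.restrict Ω) + 0)))) :=
    ENNReal.Tendsto.const_mul ((tendsto_const_nhds.add h2).add (tendsto_const_nhds.add h3))
      (.inr ENNReal.ofReal_ne_top)
  simp only [add_zero] at hlim
  calc eLpNorm v (ENNReal.ofReal (sobolevExponent d)) (volume.restrict Ω)
      ≤ atTop.liminf fun n =>
          eLpNorm (ψ n) (ENNReal.ofReal (sobolevExponent d)) (volume.restrict Ω) :=
        Lp.eLpNorm_lim_le_liminf_eLpNorm (fun n => (h1 n).memLp.1) v h4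
    _ ≤ _ := (liminf_le_liminf (.of_forall hψ)).trans hlim.liminf_eq.le

/-! ### Weights and the energy inequality -/

theorem mul_primitive_nonneg {ρ : ℝ → ℝ} (h : ∀ s, 0 ≤ ρ s) (s : ℝ) : 0 ≤ s * primitive ρ s := by
  unfold primitive
  rcases le_total 0 s with hs | hs
  · exact mul_nonneg hs (intervalIntegral.integral_nonneg hs fun t _ => h t)
  · rw [intervalIntegral.integral_symm, mul_neg, ← neg_mul]
    exact mul_nonneg (neg_nonneg.2 hs) (intervalIntegral.integral_nonneg hs fun t _ => h t)

/-- Nonnegative bounded limits of continuous functions which increase with `|s|`. -/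
structure IsWeight (ρ : ℝ → ℝ) : Prop where
  boundedLimit : BoundedLimit ρ
  nonneg : ∀ s, 0 ≤ ρ s
  mono : ∀ s t, |s| ≤ |t| → ρ s ≤ ρ t

theorem IsWeight.abs {ρ : ℝ → ℝ} (h : IsWeight ρ) (s : ℝ) : ρ |s| = ρ s :=
  le_antisymm (h.mono _ _ (by simp)) (h.mono _ _ (by simp))

theorem IsWeight.intervalIntegrable {ρ : ℝ → ℝ} (h : IsWeight ρ) (a b : ℝ) :
    IntervalIntegrable ρ volume a b := by
  obtain ⟨B, hB⟩ := h.boundedLimit.exists_bound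
  exact intervalIntegrable_of_bounded h.boundedLimit.measurable hB a b

theorem IsWeight.sq {ρ : ℝ → ℝ} (h : IsWeight ρ) : IsWeight fun s => ρ s ^ 2 :=
  ⟨h.boundedLimit.sq, fun _ => sq_nonneg _,
    fun s t hst => pow_le_pow_left₀ (h.nonneg s) (h.mono s t hst) 2⟩

theorem IsWeight.abs_primitive {ρ : ℝ → ℝ} (h : IsWeight ρ) (s : ℝ) :
    |primitive ρ s| = primitive ρ |s| := by
  have key : ∀ s, 0 ≤ s → 0 ≤ primitive ρ s := fun s hs =>
    intervalIntegral.integral_nonneg hs fun t _ => h.nonneg t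
  rcases le_total 0 s with hs | hs
  · rw [abs_of_nonneg hs, abs_of_nonneg (key s hs)]
  · have : primitive ρ |s| = -primitive ρ s := by
      unfold primitive
      rw [abs_of_nonpos hs, ← intervalIntegral.integral_symm]
      have h1 := intervalIntegral.integral_comp_neg (a := s) (b := 0) ρ
      rw [neg_zero] at h1
      rw [← h1]
      exact intervalIntegral.integral_congr fun t _ => by
        rw [← h.abs (-t), abs_neg, h.abs]
    rw [this, abs_of_nonpos]
    linarith [key |s| (abs_nonneg s)]

/-- By monotonicity `ρ(t)² ≤ ρ(s)ρ(t)` for `0 ≤ t ≤ |s|`. This makes the test function built from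
`ρ²` comparable to the product of `ρ` and its primitive, as Young's inequality requires. -/
theorem IsWeight.abs_primitive_sq_le {ρ : ℝ → ℝ} (h : IsWeight ρ) (s : ℝ) :
    |SemilinearDirichlet.primitive (fun t => ρ t ^ 2) s| ≤
      |SemilinearDirichlet.primitive ρ s| * ρ s := by
  rw [h.sq.abs_primitive, h.abs_primitive, ← h.abs s, mul_comm]
  unfold SemilinearDirichlet.primitive
  rw [← intervalIntegral.integral_const_mul]
  refine intervalIntegral.integral_mono_on (abs_nonneg s) (h.sq.intervalIntegrable _ _)
    ((h.intervalIntegrable _ _).const_mul _) fun t ht => ?_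
  rw [pow_two]
  exact mul_le_mul_of_nonneg_right
    (h.mono _ _ (by rw [abs_of_nonneg ht.1, abs_abs]; exact ht.2)) (h.nonneg t)

/-- Dividing the coerciveness condition by `|τ|` gives a one-sided bound for `f` at `τ = σ(x,s)`,
which lies between `0` and `s`. The term `μσ` is compensated by `-μs`, and the factor `t ≤ 1` only
helps because the majorant is nonnegative. -/
theorem truncRHS_sub_mul_le {f : EuclideanSpace ℝ (Fin d) → ℝ → EuclideanSpace ℝ (Fin d) → ℝ}
    {h v₀ v₁ : EuclideanSpace ℝ (Fin d) → ℝ} {δ L μ t : ℝ} {U : Set (EuclideanSpace ℝ (Fin d))}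
    {x : EuclideanSpace ℝ (Fin d)} (hδ : 0 ≤ δ) (hL : 0 ≤ L) (hμ : 0 ≤ μ) (ht : 0 ≤ t)
    (ht1 : t ≤ 1) (hh : 0 ≤ h x) (hv₀ : v₀ x ≤ 0) (hv₁ : 0 ≤ v₁ x)
    (hf : Continuous fun p : ℝ × EuclideanSpace ℝ (Fin d) => f x p.1 p.2)
    (hc : ∀ (s : ℝ) (ξ : EuclideanSpace ℝ (Fin d)),
      f x s ξ * s ≤ δ * s ^ 2 + L * ‖s • ξ‖ + h x * |s|)
    (s : ℝ) (ξ : EuclideanSpace ℝ (Fin d)) {η : ℝ} (hη : 0 ≤ s * η) (hη0 : s = 0 → η = 0) :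
    (truncRHS f μ t U v₀ v₁ x s ξ - μ * s) * η ≤ |η| * (δ * |s| + L * ‖ξ‖ + h x) := by
  have hfc : Continuous fun τ => f x τ ξ := hf.comp (by fun_prop : Continuous fun τ : ℝ => (τ, ξ))
  have hpos : ∀ τ, 0 ≤ τ → f x τ ξ ≤ δ * τ + L * ‖ξ‖ + h x := by
    have h1 : ∀ τ, 0 < τ → f x τ ξ ≤ δ * τ + L * ‖ξ‖ + h x := fun τ hτ => by
      have := hc τ ξ
      rw [norm_smul, Real.norm_eq_abs, abs_of_pos hτ] at this
      exact le_of_mul_le_mul_right (by nlinarith) hτ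
    intro τ hτ
    rcases hτ.eq_or_lt with rfl | hτ
    · refine le_of_tendsto_of_tendsto (b := 𝓝[>] (0 : ℝ))
        ((hfc.tendsto 0).mono_left nhdsWithin_le_nhds)
        (((by fun_prop : Continuous fun τ : ℝ => δ * τ + L * ‖ξ‖ + h x).tendsto 0).mono_left
          nhdsWithin_le_nhds) ?_
      filter_upwards [self_mem_nhdsWithin] with τ hτ using h1 τ hτ
    · exact h1 τ hτ
  have hneg : ∀ τ, τ ≤ 0 → -f x τ ξ ≤ δ * -τ + L * ‖ξ‖ + h x := by
    have h1 : ∀ τ, τ < 0 → -f x τ ξ ≤ δ * -τ + L * ‖ξ‖ + h x := fun τ hτ => by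
      have := hc τ ξ
      rw [norm_smul, Real.norm_eq_abs, abs_of_neg hτ] at this
      exact le_of_mul_le_mul_right (by nlinarith) (neg_pos.2 hτ)
    intro τ hτ
    rcases hτ.eq_or_lt with rfl | hτ
    · refine le_of_tendsto_of_tendsto (b := 𝓝[<] (0 : ℝ))
        ((hfc.neg.tendsto 0).mono_left nhdsWithin_le_nhds)
        (((by fun_prop : Continuous fun τ : ℝ => δ * -τ + L * ‖ξ‖ + h x).tendsto 0).mono_left
          nhdsWithin_le_nhds) ?_
      filter_upwards [self_mem_nhdsWithin] with τ hτ using h1 τ hτ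
    · exact h1 τ hτ
  have hξ : 0 ≤ L * ‖ξ‖ := by positivity
  rcases lt_trichotomy s 0 with hs | rfl | hs
  · have hη' : η ≤ 0 := by
      by_contra hcon
      push Not at hcon
      linarith [mul_neg_of_neg_of_pos hs hcon]
    rw [abs_of_neg hs, abs_of_nonpos hη']
    suffices h1 : -(truncRHS f μ t U v₀ v₁ x s ξ - μ * s) ≤ δ * -s + L * ‖ξ‖ + h x by
      nlinarith
    have hσ0 : trunc v₀ v₁ x s ≤ 0 := max_le hv₀ ((min_le_left _ _).trans hs.le)
    have hσs : s ≤ trunc v₀ v₁ x s := le_max_of_le_right (le_min le_rfl (hs.le.trans hv₁))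
    unfold truncRHS
    by_cases hxU : x ∈ U
    · rw [Set.indicator_of_mem hxU]
      unfold bTrunc
      have h2 := hneg _ hσ0
      have hN : 0 ≤ δ * -s + L * ‖ξ‖ + h x + μ * -s := by nlinarith
      have hA : -(f x (trunc v₀ v₁ x s) ξ + μ * trunc v₀ v₁ x s) ≤
          δ * -s + L * ‖ξ‖ + h x + μ * -s := by nlinarith
      nlinarith [mul_le_mul_of_nonneg_left hA ht, mul_le_mul_of_nonneg_right ht1 hN]
    · rw [Set.indicator_of_notMem hxU]
      nlinarith
  · simp [hη0 rfl]
  · have hη' : 0 ≤ η := by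
      by_contra hcon
      push Not at hcon
      linarith [mul_neg_of_pos_of_neg hs hcon]
    rw [abs_of_pos hs, abs_of_nonneg hη', mul_comm]
    refine mul_le_mul_of_nonneg_left ?_ hη'
    have hσ0 : 0 ≤ trunc v₀ v₁ x s := le_max_of_le_right (le_min hs.le hv₁)
    have hσs : trunc v₀ v₁ x s ≤ s := max_le (hv₀.trans hs.le) (min_le_left _ _)
    unfold truncRHS
    by_cases hxU : x ∈ U
    · rw [Set.indicator_of_mem hxU]
      unfold bTrunc
      have h2 := hpos _ hσ0
      have hN : 0 ≤ δ * s + L * ‖ξ‖ + h x + μ * s := by positivity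
      have hA : f x (trunc v₀ v₁ x s) ξ + μ * trunc v₀ v₁ x s ≤
          δ * s + L * ‖ξ‖ + h x + μ * s := by nlinarith
      nlinarith [mul_le_mul_of_nonneg_left hA ht, mul_le_mul_of_nonneg_right ht1 hN]
    · rw [Set.indicator_of_notMem hxU]
      have : 0 ≤ δ * s + L * ‖ξ‖ + h x + μ * s := by positivity
      linarith

/-- `u` satisfies, in the weak sense, `-Δ|u| ≤ δ |u| + L |∇u| + |h|`. -/
structure IsWeakSubsolution (Ω : Set (EuclideanSpace ℝ (Fin d))) (δ L : ℝ)
    (h u : EuclideanSpace ℝ (Fin d) → ℝ)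
    (G : EuclideanSpace ℝ (Fin d) → EuclideanSpace ℝ (Fin d)) : Prop where
  inH10 : InH10 Ω u G
  memLp : MemLp h 2 (volume.restrict Ω)
  energy : ∀ ρ : ℝ → ℝ, BoundedLimit ρ → (∀ s, 0 ≤ ρ s) →
    ∫ x in Ω, ρ (u x) * ‖G x‖ ^ 2 ≤
      ∫ x in Ω, |primitive ρ (u x)| * (δ * |u x| + L * ‖G x‖ + |h x|)

theorem isWeakSubsolution_of_isWeakSolution
    {f : EuclideanSpace ℝ (Fin d) → ℝ → EuclideanSpace ℝ (Fin d) → ℝ}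
    {h v₀ v₁ u : EuclideanSpace ℝ (Fin d) → ℝ} {δ L μ t : ℝ} {U : Set (EuclideanSpace ℝ (Fin d))}
    (hδ : 0 ≤ δ) (hL : 0 ≤ L) (hμ : 0 ≤ μ) (ht : 0 ≤ t) (ht1 : t ≤ 1)
    (hf : IsCaratheodory Ω f) (hh : ∀ᵐ x ∂(volume.restrict Ω), 0 ≤ h x)
    (hh2 : MemLp h 2 (volume.restrict Ω)) (hc : IsCoercive Ω f δ L h)
    (hv₀ : ∀ᵐ x ∂(volume.restrict Ω), v₀ x ≤ 0) (hv₁ : ∀ᵐ x ∂(volume.restrict Ω), 0 ≤ v₁ x)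
    (hu : IsWeakSolution Ω μ (truncRHS f μ t U v₀ v₁) u) :
    ∃ G, IsWeakSubsolution Ω δ L h u G := by
  obtain ⟨G, hH, hg, hw⟩ := hu
  have hI := hH.inH10
  refine ⟨G, hI, hh2, fun ρ hρ hρ0 => ?_⟩
  set g := fun x => truncRHS f μ t U v₀ v₁ x (u x) (G x)
  have hP := hI.primitive hρ
  have hgu : MemLp (fun x => g x - μ * u x) 2 (volume.restrict Ω) := hg.sub (hI.memLp.const_mul μ)
  -- The term `μu` moves to the right-hand side, and the primitive of `ρ` at `u` becomes an
  -- admissible test function.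
  have hid := hP.weak_formulation hI.memLp_grad hgu fun φ hφ => by
    have i1 : Integrable (fun x => g x * φ x) (volume.restrict Ω) :=
      MemLp.integrable_mul hg hφ.memLp
    have i2 : Integrable (fun x => u x * φ x) (volume.restrict Ω) :=
      MemLp.integrable_mul hI.memLp hφ.memLp
    have e : ∀ x, (g x - μ * u x) * φ x = g x * φ x - μ * (u x * φ x) := fun x => by ring
    simp only [e]
    rw [integral_sub i1 (i2.const_mul μ), integral_const_mul, ← hw φ hφ]
    ring
  have e1 : ∀ x, inner ℝ (G x) (ρ (u x) • G x) = ρ (u x) * ‖G x‖ ^ 2 := fun x => by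
    rw [real_inner_smul_right, real_inner_self_eq_norm_sq]
  simp only [e1] at hid
  rw [hid]
  have hsum : MemLp (fun x => δ * |u x| + L * ‖G x‖ + |h x|) 2 (volume.restrict Ω) :=
    ((hI.memLp.abs.const_mul δ).add (hI.memLp_grad.norm.const_mul L)).add hh2.abs
  refine integral_mono_ae (MemLp.integrable_mul hgu hP.memLp)
    (MemLp.integrable_mul hP.memLp.abs hsum) ?_
  filter_upwards [hh, hv₀, hv₁, hf.continuous, hc] with x h1 h2 h3 h4 h5
  have := truncRHS_sub_mul_le (U := U) hδ hL hμ ht ht1 h1 h2 h3 h4 h5 (u x) (G x)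
    (mul_primitive_nonneg hρ0 (u x)) (fun h0 => by simp [h0, SemilinearDirichlet.primitive])
  rwa [abs_of_nonneg h1]

/-! ### The Caccioppoli and Sobolev estimates -/

theorem IsWeight.memLp_mul {ρ : ℝ → ℝ} (hρ : IsWeight ρ)
    {u v : EuclideanSpace ℝ (Fin d) → ℝ} (hu : MemLp u 2 (volume.restrict Ω))
    (hv : MemLp v 2 (volume.restrict Ω)) :
    MemLp (fun x => ρ (u x) * |v x|) 2 (volume.restrict Ω) := by
  obtain ⟨B, hB⟩ := hρ.boundedLimit.exists_bound
  have hm : AEStronglyMeasurable (fun x => ρ (u x)) (volume.restrict Ω) :=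
    (hρ.boundedLimit.measurable.comp_aemeasurable hu.1.aemeasurable).aestronglyMeasurable
  refine hv.of_le_mul (c := B) (hm.mul hv.abs.1) (.of_forall fun x => ?_)
  rw [norm_mul, Real.norm_eq_abs, Real.norm_eq_abs, abs_abs, Real.norm_eq_abs]
  exact mul_le_mul_of_nonneg_right (hB _) (abs_nonneg _)

theorem eLpNorm_two_sq {α F : Type*} [MeasurableSpace α] {μ : Measure α} [NormedAddCommGroup F]
    (f : α → F) : eLpNorm f 2 μ ^ 2 = ∫⁻ x, ‖f x‖ₑ ^ 2 ∂μ := by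
  have := eLpNorm_nnreal_pow_eq_lintegral (f := f) (μ := μ) (p := 2) (by simp)
  simpa using this

theorem ofReal_integral_norm_sq {α F : Type*} [MeasurableSpace α] {μ : Measure α}
    [NormedAddCommGroup F] {f : α → F} (hf : MemLp f 2 μ) :
    ENNReal.ofReal (∫ x, ‖f x‖ ^ 2 ∂μ) = ∫⁻ x, ‖f x‖ₑ ^ 2 ∂μ := by
  have := ofReal_integral_norm_eq_lintegral_enorm hf.norm.integrable_sq
  simpa using this

theorem ennreal_add_sq_le (a b : ℝ≥0∞) : (a + b) ^ 2 ≤ 4 * (a ^ 2 + b ^ 2) := by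
  rcases le_total a b with h | h
  · calc (a + b) ^ 2 ≤ (b + b) ^ 2 := by gcongr
      _ = 4 * b ^ 2 := by ring
      _ ≤ _ := by gcongr; exact le_add_self
  · calc (a + b) ^ 2 ≤ (a + a) ^ 2 := by gcongr
      _ = 4 * a ^ 2 := by ring
      _ ≤ _ := by gcongr; exact le_self_add

theorem IsWeakSubsolution.caccioppoli {δ L : ℝ} {h u : EuclideanSpace ℝ (Fin d) → ℝ}
    {G : EuclideanSpace ℝ (Fin d) → EuclideanSpace ℝ (Fin d)} (hδ : 0 ≤ δ) (hL : 0 ≤ L)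
    (hu : IsWeakSubsolution Ω δ L h u G) {ρ : ℝ → ℝ} (hρ : IsWeight ρ) :
    ∫ x in Ω, ‖ρ (u x) • G x‖ ^ 2 ≤ L ^ 2 * (∫ x in Ω, primitive ρ (u x) ^ 2) +
      2 * δ * (∫ x in Ω, |primitive ρ (u x)| * ρ (u x) * |u x|) +
      2 * (∫ x in Ω, |primitive ρ (u x)| * ρ (u x) * |h x|) := by
  have hΓ := (hu.inH10.primitive hρ.boundedLimit).memLp
  have hH := (hu.inH10.primitive hρ.boundedLimit).memLp_grad
  have hη := (hu.inH10.primitive hρ.sq.boundedLimit).memLp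
  have hh := hu.memLp
  have hρu := hρ.memLp_mul hu.inH10.memLp hu.inH10.memLp
  have hρh := hρ.memLp_mul hu.inH10.memLp hh
  have hE := hu.energy _ hρ.sq.boundedLimit hρ.sq.nonneg
  have e0 : ∀ x, ‖ρ (u x) • G x‖ ^ 2 = ρ (u x) ^ 2 * ‖G x‖ ^ 2 := fun x => by
    rw [norm_smul, mul_pow, Real.norm_eq_abs, sq_abs]
  have iX := hΓ.integrable_sq
  have iH : Integrable (fun x => ‖ρ (u x) • G x‖ ^ 2) (volume.restrict Ω) := hH.norm.integrable_sq
  have iY : Integrable (fun x => |SemilinearDirichlet.primitive ρ (u x)| * ρ (u x) * |u x|)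
      (volume.restrict Ω) := by
    simp only [mul_assoc]
    exact MemLp.integrable_mul hΓ.abs hρu
  have iZ : Integrable (fun x => |SemilinearDirichlet.primitive ρ (u x)| * ρ (u x) * |h x|)
      (volume.restrict Ω) := by
    simp only [mul_assoc]
    exact MemLp.integrable_mul hΓ.abs hρh
  have hsum : MemLp (fun x => δ * |u x| + L * ‖G x‖ + |h x|) 2 (volume.restrict Ω) :=
    ((hu.inH10.memLp.abs.const_mul δ).add (hu.inH10.memLp_grad.norm.const_mul L)).add hh.abs
  -- Young's inequality `L|Γ|ρ|G| ≤ L²Γ²/2 + ρ²|G|²/2`, with `Γ` the primitive of `ρ`; the last term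
  -- is half of the left-hand side and is absorbed.
  have hmono := integral_mono (MemLp.integrable_mul hη.abs hsum)
    ((((iX.const_mul (L ^ 2 / 2)).add (iY.const_mul δ)).add iZ).add (iH.const_mul (1 / 2)))
    fun x => by
      have h1 := hρ.abs_primitive_sq_le (u x)
      have h2 := hρ.nonneg (u x)
      have h3 : 0 ≤ δ * |u x| + L * ‖G x‖ + |h x| := by positivity
      simp only [Pi.mul_apply, Pi.add_apply]
      refine (mul_le_mul_of_nonneg_right h1 h3).trans ?_
      rw [e0, ← sq_abs (SemilinearDirichlet.primitive ρ (u x))]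
      nlinarith [sq_nonneg (L * |SemilinearDirichlet.primitive ρ (u x)| - ρ (u x) * ‖G x‖)]
  rw [integral_add' (((iX.const_mul (L ^ 2 / 2)).add (iY.const_mul δ)).add iZ)
      (iH.const_mul (1 / 2)),
    integral_add' ((iX.const_mul (L ^ 2 / 2)).add (iY.const_mul δ)) iZ,
    integral_add' (iX.const_mul (L ^ 2 / 2)) (iY.const_mul δ), integral_const_mul,
    integral_const_mul, integral_const_mul] at hmono
  have hE' := hE.trans hmono
  simp only [← e0] at hE'
  linarith

/-- The Sobolev-Caccioppoli estimate for the functions `primitive ρ ∘ u`, `ρ` a weight. -/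
def SobolevBound (Ω : Set (EuclideanSpace ℝ (Fin d))) (C r : ℝ)
    (h u : EuclideanSpace ℝ (Fin d) → ℝ) : Prop :=
  ∀ ρ : ℝ → ℝ, IsWeight ρ →
    eLpNorm (fun x => primitive ρ (u x)) (ENNReal.ofReal r) (volume.restrict Ω) ≠ ⊤ ∧
    eLpNorm (fun x => primitive ρ (u x)) (ENNReal.ofReal r) (volume.restrict Ω) ^ 2 ≤
      ENNReal.ofReal C * ((∫⁻ x in Ω, ‖primitive ρ (u x)‖ₑ ^ 2) +
        (∫⁻ x in Ω, ‖primitive ρ (u x)‖ₑ * ‖ρ (u x)‖ₑ * ‖u x‖ₑ) +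
        ∫⁻ x in Ω, ‖primitive ρ (u x)‖ₑ * ‖ρ (u x)‖ₑ * ‖h x‖ₑ)

theorem IsWeakSubsolution.sobolevBound (d : ℕ) {δ L : ℝ} (hδ : 0 ≤ δ) (hL : 0 ≤ L) :
    ∃ C : ℝ, 0 < C ∧ ∀ (Ω : Set (EuclideanSpace ℝ (Fin d))) (h u : EuclideanSpace ℝ (Fin d) → ℝ)
      (G : EuclideanSpace ℝ (Fin d) → EuclideanSpace ℝ (Fin d)),
      IsWeakSubsolution Ω δ L h u G → SobolevBound Ω C (sobolevExponent d) h u := by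
  obtain ⟨C, hC, hS⟩ := InH10.sobolev d
  -- The factor `4` comes from squaring a sum; `1` and `L² + 2δ + 2` bound the squared `L_2`-norms
  -- of the function and of its gradient by the sum of the three integrals.
  refine ⟨4 * C ^ 2 * (1 + (L ^ 2 + 2 * δ + 2)), by positivity, fun Ω h u G hu ρ hρ => ?_⟩
  have hI := hu.inH10.primitive hρ.boundedLimit
  have hS' := hS Ω _ _ hI
  have hfin : ENNReal.ofReal C * (eLpNorm (fun x => SemilinearDirichlet.primitive ρ (u x)) 2
      (volume.restrict Ω) + eLpNorm (fun x => ρ (u x) • G x) 2 (volume.restrict Ω)) ≠ ⊤ :=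
    ENNReal.mul_ne_top ENNReal.ofReal_ne_top
      (ENNReal.add_ne_top.2 ⟨hI.memLp.2.ne, hI.memLp_grad.2.ne⟩)
  refine ⟨ne_top_of_le_ne_top hfin hS', ?_⟩
  have hρu := hρ.memLp_mul hu.inH10.memLp hu.inH10.memLp
  have hρh := hρ.memLp_mul hu.inH10.memLp hu.memLp
  have eX : ENNReal.ofReal (∫ x in Ω, SemilinearDirichlet.primitive ρ (u x) ^ 2) =
      ∫⁻ x in Ω, ‖SemilinearDirichlet.primitive ρ (u x)‖ₑ ^ 2 := by
    rw [← ofReal_integral_norm_sq hI.memLp]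
    simp
  have eP : ∀ v : EuclideanSpace ℝ (Fin d) → ℝ,
      MemLp (fun x => ρ (u x) * |v x|) 2 (volume.restrict Ω) →
      ENNReal.ofReal (∫ x in Ω, |SemilinearDirichlet.primitive ρ (u x)| * ρ (u x) * |v x|) =
        ∫⁻ x in Ω, ‖SemilinearDirichlet.primitive ρ (u x)‖ₑ * ‖ρ (u x)‖ₑ * ‖v x‖ₑ := by
    intro v hv
    have i : Integrable (fun x => SemilinearDirichlet.primitive ρ (u x) * (ρ (u x) * |v x|))
      (volume.restrict Ω) := MemLp.integrable_mul hI.memLp hv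
    have := ofReal_integral_norm_eq_lintegral_enorm i
    simpa [abs_mul, abs_of_nonneg (hρ.nonneg _), mul_assoc] using this
  have hcac := hu.caccioppoli hδ hL hρ
  set X := ∫ x in Ω, SemilinearDirichlet.primitive ρ (u x) ^ 2
  set Y := ∫ x in Ω, |SemilinearDirichlet.primitive ρ (u x)| * ρ (u x) * |u x|
  set Z := ∫ x in Ω, |SemilinearDirichlet.primitive ρ (u x)| * ρ (u x) * |h x|
  have hX0 : 0 ≤ X := integral_nonneg fun x => sq_nonneg _
  have hY0 : 0 ≤ Y := integral_nonneg fun x =>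
    mul_nonneg (mul_nonneg (abs_nonneg _) (hρ.nonneg _)) (abs_nonneg _)
  have hZ0 : 0 ≤ Z := integral_nonneg fun x =>
    mul_nonneg (mul_nonneg (abs_nonneg _) (hρ.nonneg _)) (abs_nonneg _)
  rw [← eX, ← eP u hρu, ← eP h hρh, ← ENNReal.ofReal_add hX0 hY0,
    ← ENNReal.ofReal_add (add_nonneg hX0 hY0) hZ0, ← ENNReal.ofReal_mul (by positivity)]
  have hG2 : eLpNorm (fun x => ρ (u x) • G x) 2 (volume.restrict Ω) ^ 2 ≤
      ENNReal.ofReal ((L ^ 2 + 2 * δ + 2) * (X + Y + Z)) := by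
    rw [eLpNorm_two_sq, ← ofReal_integral_norm_sq hI.memLp_grad]
    refine ENNReal.ofReal_le_ofReal (hcac.trans ?_)
    have := sq_nonneg L
    nlinarith [mul_nonneg this hY0, mul_nonneg this hZ0, mul_nonneg hδ hX0, mul_nonneg hδ hZ0]
  have hΓ2 : eLpNorm (fun x => SemilinearDirichlet.primitive ρ (u x)) 2 (volume.restrict Ω) ^ 2 ≤
      ENNReal.ofReal (1 * (X + Y + Z)) := by
    rw [eLpNorm_two_sq, ← eX]
    exact ENNReal.ofReal_le_ofReal (by linarith)
  calc _ ≤ (ENNReal.ofReal C * (eLpNorm (fun x => SemilinearDirichlet.primitive ρ (u x)) 2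
        (volume.restrict Ω) + eLpNorm (fun x => ρ (u x) • G x) 2 (volume.restrict Ω))) ^ 2 := by
        gcongr
    _ ≤ ENNReal.ofReal C ^ 2 * (4 * (eLpNorm (fun x => SemilinearDirichlet.primitive ρ (u x)) 2
        (volume.restrict Ω) ^ 2 + eLpNorm (fun x => ρ (u x) • G x) 2 (volume.restrict Ω) ^ 2)) := by
        rw [mul_pow]
        gcongr ENNReal.ofReal C ^ 2 * ?_
        exact ennreal_add_sq_le _ _
    _ ≤ ENNReal.ofReal C ^ 2 * (4 * (ENNReal.ofReal (1 * (X + Y + Z)) +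
          ENNReal.ofReal ((L ^ 2 + 2 * δ + 2) * (X + Y + Z)))) := by gcongr
    _ = _ := by
        rw [← ENNReal.ofReal_add (by positivity) (by positivity), ← ENNReal.ofReal_pow hC.le,
          show (4 : ℝ≥0∞) = ENNReal.ofReal 4 by simp, ← ENNReal.ofReal_mul (by positivity),
          ← ENNReal.ofReal_mul (by positivity)]
        congr 1
        ring

/-! ### Hölder's inequality on supports -/

section Holder

variable {α : Type*} [MeasurableSpace α] {μ : Measure α}

theorem eLpNorm_le_mul_rpow_measure_of_support_subset {f : α → ℝ} {A : Set α}
    (hf : AEStronglyMeasurable f μ) (hA : f.support ⊆ A) {p r : ℝ} (hp : 0 < p) (hpr : p ≤ r) :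
    eLpNorm f (ENNReal.ofReal p) μ ≤
      eLpNorm f (ENNReal.ofReal r) μ * μ A ^ (1 / p - 1 / r) := by
  have h := eLpNorm_le_eLpNorm_mul_rpow_measure_univ (μ := μ.restrict A)
    (ENNReal.ofReal_le_ofReal hpr) (hf.mono_measure Measure.restrict_le_self)
  rwa [eLpNorm_restrict_eq_of_support_subset hA, eLpNorm_restrict_eq_of_support_subset hA,
    Measure.restrict_apply_univ, ENNReal.toReal_ofReal hp.le,
    ENNReal.toReal_ofReal (hp.le.trans hpr)] at h

theorem lintegral_enorm_le_of_support_subset {f : α → ℝ} {A : Set α}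
    (hf : AEStronglyMeasurable f μ) (hA : f.support ⊆ A) {r : ℝ} (hr : 1 ≤ r) :
    ∫⁻ x, ‖f x‖ₑ ∂μ ≤ eLpNorm f (ENNReal.ofReal r) μ * μ A ^ (1 - 1 / r) := by
  have := eLpNorm_le_mul_rpow_measure_of_support_subset hf hA one_pos hr
  simpa [eLpNorm_one_eq_lintegral_enorm] using this

theorem lintegral_enorm_sq_le_of_support_subset {f : α → ℝ} {A : Set α}
    (hf : AEStronglyMeasurable f μ) (hA : f.support ⊆ A) {r : ℝ} (hr : 2 ≤ r) :
    ∫⁻ x, ‖f x‖ₑ ^ 2 ∂μ ≤ eLpNorm f (ENNReal.ofReal r) μ ^ 2 * μ A ^ (1 - 2 / r) := by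
  have := eLpNorm_le_mul_rpow_measure_of_support_subset hf hA two_pos hr
  rw [← eLpNorm_two_sq]
  calc eLpNorm f 2 μ ^ 2 ≤ (eLpNorm f (ENNReal.ofReal r) μ * μ A ^ (1 / 2 - 1 / r)) ^ 2 := by
        gcongr
        simpa using this
    _ = _ := by
        rw [mul_pow, ← ENNReal.rpow_mul_natCast]
        congr 2
        push_cast
        ring

theorem lintegral_enorm_mul_le {f g : α → ℝ} (hf : AEStronglyMeasurable f μ)
    (hg : AEStronglyMeasurable g μ) {p q : ℝ} (hpq : p.HolderConjugate q) :
    ∫⁻ x, ‖f x‖ₑ * ‖g x‖ₑ ∂μ ≤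
      eLpNorm f (ENNReal.ofReal p) μ * eLpNorm g (ENNReal.ofReal q) μ := by
  have := ENNReal.lintegral_mul_le_Lp_mul_Lq μ hpq hf.enorm hg.enorm
  have hp := hpq.pos
  have hq := hpq.symm.pos
  simpa [eLpNorm_eq_lintegral_rpow_enorm_toReal, hp, hq, hp.le, hq.le, not_le] using this

theorem lintegral_enorm_mul_le_of_support_subset {f g : α → ℝ} {A : Set α}
    (hf : AEStronglyMeasurable f μ) (hg : AEStronglyMeasurable g μ) (hA : f.support ⊆ A) {q r : ℝ}
    (hq : 1 < q) (hr : 0 < r) (hqr : 1 / q + 1 / r ≤ 1) :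
    ∫⁻ x, ‖f x‖ₑ * ‖g x‖ₑ ∂μ ≤ eLpNorm g (ENNReal.ofReal q) μ *
      (eLpNorm f (ENNReal.ofReal r) μ * μ A ^ (1 - 1 / q - 1 / r)) := by
  have hc := (Real.HolderConjugate.conjExponent hq).symm
  refine (lintegral_enorm_mul_le hf hg hc).trans ?_
  rw [mul_comm]
  gcongr
  have h1 : 1 / q.conjExponent = 1 - 1 / q := by
    have := hc.inv_add_inv_eq_one
    simp only [one_div]
    linarith
  have h2 := eLpNorm_le_mul_rpow_measure_of_support_subset hf hA hc.pos (r := r)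
    ((one_div_le_one_div hr hc.pos).1 (by linarith))
  rwa [h1] at h2

end Holder

/-! ### Level sets and the supremum bound for `q > d/2` -/

theorem isWeight_indicator (a : ℝ) : IsWeight fun s => if a < |s| then 1 else 0 := by
  refine ⟨⟨fun n s => min 1 (n * max (|s| - a) 0), 1, fun n => by fun_prop, fun n s => ?_,
    fun s => ?_⟩, fun s => by split_ifs <;> norm_num, fun s t hst => ?_⟩
  · rw [abs_of_nonneg (by positivity)]
    exact min_le_left _ _
  · beta_reduce
    split_ifs with h
    · have h1 : Tendsto (fun n : ℕ => (n : ℝ) * max (|s| - a) 0) atTop atTop :=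
        tendsto_natCast_atTop_atTop.atTop_mul_const (lt_max_of_lt_left (sub_pos.2 h))
      refine tendsto_const_nhds.congr' ?_
      filter_upwards [h1.eventually_ge_atTop 1] with n hn using (min_eq_left hn).symm
    · rw [max_eq_right (by linarith)]
      simp
  · split_ifs <;> first | (norm_num; done) | linarith

theorem abs_primitive_indicator {a : ℝ} (ha : 0 ≤ a) (s : ℝ) :
    |primitive (fun s => if a < |s| then 1 else 0) s| = max (|s| - a) 0 := by
  have hw := isWeight_indicator a
  rw [hw.abs_primitive]
  have h0 : ∀ b, 0 ≤ b → b ≤ a →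
      ∫ t in (0 : ℝ)..b, (if a < |t| then (1 : ℝ) else 0) = 0 := fun b hb hba => by
    rw [intervalIntegral.integral_congr (g := fun _ => (0 : ℝ))]
    · simp
    · intro t ht
      rw [Set.uIcc_of_le hb] at ht
      have : ¬ a < |t| := by rw [abs_of_nonneg ht.1]; linarith [ht.2]
      simp [this]
  unfold primitive
  rcases le_total |s| a with h | h
  · rw [h0 _ (abs_nonneg s) h, max_eq_right (by linarith)]
  · rw [← intervalIntegral.integral_add_adjacent_intervals (hw.intervalIntegrable 0 a)
      (hw.intervalIntegrable a |s|), h0 a ha le_rfl, zero_add, max_eq_left (by linarith),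
      intervalIntegral.integral_congr_ae (g := fun _ => (1 : ℝ))]
    · simp
    · refine .of_forall fun t ht => ?_
      rw [Set.uIoc_of_le h] at ht
      have : a < |t| := ht.1.trans_le (le_abs_self t)
      simp [this]

theorem measure_lt_abs_le {α : Type*} [MeasurableSpace α] {μ : Measure α} {u : α → ℝ}
    (hu : AEStronglyMeasurable u μ) {a : ℝ} (ha : 0 < a) :
    μ {x | a < |u x|} ≤ (eLpNorm u 2 μ / ENNReal.ofReal a) ^ 2 := by
  have h := mul_meas_ge_le_pow_eLpNorm' μ (p := 2) (by simp) (by simp) hu (ENNReal.ofReal a)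
  have h1 : μ {x | a < |u x|} ≤ μ {x | ENNReal.ofReal a ≤ ‖u x‖ₑ} := by
    refine measure_mono fun x hx => ?_
    simp only [Set.mem_ofPred_eq, Real.enorm_eq_ofReal_abs] at hx ⊢
    exact ENNReal.ofReal_le_ofReal hx.le
  have ha0 : ENNReal.ofReal a ^ 2 ≠ 0 := by simp [ha]
  rw [div_eq_mul_inv, mul_pow, ← ENNReal.inv_pow, ← div_eq_mul_inv,
    ENNReal.le_div_iff_mul_le (.inl ha0) (.inl (by finiteness)), mul_comm]
  calc ENNReal.ofReal a ^ 2 * μ {x | a < |u x|}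
      ≤ ENNReal.ofReal a ^ 2 * μ {x | ENNReal.ofReal a ≤ ‖u x‖ₑ} := by gcongr
    _ ≤ eLpNorm u 2 μ ^ 2 := by simpa using h

theorem le_of_sq_le_mul_sq_add {C x P Q : ℝ} (hx : 0 ≤ x) (hP : 4 * C * P ≤ 1) (hC : 0 ≤ C) (hQ : 0 ≤ Q)
    (h : x ^ 2 ≤ C * (2 * (x ^ 2 * P) + x * Q)) : x ≤ 2 * C * Q := by
  rcases hx.eq_or_lt with rfl | hx
  · positivity
  · have h1 : 4 * C * P * x ^ 2 ≤ 1 * x ^ 2 := by gcongr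
    have h2 : x * x ≤ (2 * C * Q) * x := by nlinarith
    exact le_of_mul_le_mul_right h2 hx

/-- With `w` of modulus `(|u|-a)₊` and `m` the measure of its support, Hölder's inequality bounds
`‖w‖_r` by multiples of `‖w‖_r² m^(1-2/r)`, absorbed for small `m`, and of powers of `m`.
Chebyshev's inequality for `∫|w| ≤ ‖w‖_r m^(1-1/r)` adds a further power. The iteration works
because the total exponent exceeds `1` when `1/q + 2/r < 1`. -/
theorem SobolevBound.level_set {C r q : ℝ} {h u : EuclideanSpace ℝ (Fin d) → ℝ}
    (hS : SobolevBound Ω C r h u) (hC : 0 < C) (hr : 2 < r) (hq : 1 < q)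
    (hqr : 1 / q + 1 / r ≤ 1) (hu : AEStronglyMeasurable u (volume.restrict Ω))
    (hh : MemLp h (ENNReal.ofReal q) (volume.restrict Ω)) {a b : ℝ} (ha : 0 ≤ a) (hab : a < b)
    (hm1 : volume.restrict Ω {x | a < |u x|} ≤ 1)
    (hm2 : 4 * C * (volume.restrict Ω {x | a < |u x|}).toReal ^ (1 - 2 / r) ≤ 1) :
    (b - a) * (volume.restrict Ω {x | b < |u x|}).toReal ≤
      2 * C * (a + (eLpNorm h (ENNReal.ofReal q) (volume.restrict Ω)).toReal) *
        (volume.restrict Ω {x | a < |u x|}).toReal ^ (2 - 1 / q - 2 / r) := by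
  set ν := volume.restrict Ω
  set A := {x | a < |u x|}
  set ρ : ℝ → ℝ := fun s => if a < |s| then 1 else 0 with hρ
  have hρw : IsWeight ρ := isWeight_indicator a
  set w := fun x => primitive ρ (u x) with hw
  have hwabs : ∀ x, |w x| = max (|u x| - a) 0 := fun x => abs_primitive_indicator ha _
  obtain ⟨hXt, hX⟩ := hS ρ hρw
  obtain ⟨B, hB⟩ := hρw.boundedLimit.exists_bound
  have hwm : AEStronglyMeasurable w ν :=
    (continuous_primitive hρw.boundedLimit.measurable hB).comp_aestronglyMeasurable hu
  have hwA : w.support ⊆ A := fun x hx => by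
    by_contra hcon
    have : |w x| = 0 := by rw [hwabs, max_eq_right]; simp [A] at hcon; linarith
    exact hx (abs_eq_zero.1 this)
  have i2 := lintegral_enorm_sq_le_of_support_subset hwm hwA hr.le
  have i1 := lintegral_enorm_le_of_support_subset hwm hwA (by linarith : 1 ≤ r)
  have ih := lintegral_enorm_mul_le_of_support_subset hwm hh.1 hwA hq (by linarith) hqr
  have hρ1 : ∀ s, ‖ρ s‖ₑ ≤ 1 := fun s => by
    simp only [hρ]; split_ifs <;> simp
  have j1 : ∫⁻ x, ‖w x‖ₑ * ‖ρ (u x)‖ₑ * ‖u x‖ₑ ∂ν ≤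
      (∫⁻ x, ‖w x‖ₑ ^ 2 ∂ν) + ENNReal.ofReal a * ∫⁻ x, ‖w x‖ₑ ∂ν := by
    rw [← lintegral_const_mul' _ _ ENNReal.ofReal_ne_top, ← lintegral_add_left' (by fun_prop)]
    refine lintegral_mono fun x => ?_
    calc ‖w x‖ₑ * ‖ρ (u x)‖ₑ * ‖u x‖ₑ ≤ ‖w x‖ₑ * 1 * (‖w x‖ₑ + ENNReal.ofReal a) := by
          gcongr
          · exact hρ1 _
          · simp only [Real.enorm_eq_ofReal_abs]
            rw [← ENNReal.ofReal_add (abs_nonneg _) ha, hwabs]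
            exact ENNReal.ofReal_le_ofReal (by linarith [le_max_left (|u x| - a) 0])
      _ = _ := by ring
  have j2 : ∫⁻ x, ‖w x‖ₑ * ‖ρ (u x)‖ₑ * ‖h x‖ₑ ∂ν ≤ ∫⁻ x, ‖w x‖ₑ * ‖h x‖ₑ ∂ν := by
    refine lintegral_mono fun x => ?_
    gcongr
    exact mul_le_of_le_one_right' (hρ1 _)
  have jb : ENNReal.ofReal (b - a) * ν {x | b < |u x|} ≤ ∫⁻ x, ‖w x‖ₑ ∂ν := by
    refine le_trans ?_ (mul_meas_ge_le_lintegral₀ hwm.enorm (ENNReal.ofReal (b - a)))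
    gcongr with x
    intro hx
    rw [Real.enorm_eq_ofReal_abs, hwabs]
    exact ENNReal.ofReal_le_ofReal (le_max_of_le_left (by linarith))
  set X := eLpNorm w (ENNReal.ofReal r) ν
  set H := eLpNorm h (ENNReal.ofReal q) ν
  have hHt : H ≠ ⊤ := hh.2.ne
  have hmt : ν A ≠ ⊤ := ne_top_of_le_ne_top ENNReal.one_ne_top hm1
  set m := (ν A).toReal with hm
  have hm0 : 0 ≤ m := ENNReal.toReal_nonneg
  have hm1' : m ≤ 1 := by simpa using ENNReal.toReal_mono ENNReal.one_ne_top hm1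
  have e1 : 0 < 1 - 2 / r := by rw [sub_pos, div_lt_one (by linarith)]; exact hr
  have e2 : 0 ≤ 1 - 1 / r := by
    have : 0 < 1 / r := by positivity
    have : 2 / r = 2 * (1 / r) := by ring
    linarith
  have e3 : 0 ≤ 1 - 1 / q - 1 / r := by linarith
  have hmA : ∀ e : ℝ, 0 ≤ e → ν A ^ e = ENNReal.ofReal (m ^ e) := fun e he => by
    rw [← ENNReal.ofReal_toReal hmt, ENNReal.ofReal_rpow_of_nonneg hm0 he]
  rw [hmA _ e1.le, ← ENNReal.ofReal_toReal hXt] at i2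
  rw [hmA _ e2, ← ENNReal.ofReal_toReal hXt] at i1
  rw [hmA _ e3, ← ENNReal.ofReal_toReal hXt, ← ENNReal.ofReal_toReal hHt] at ih
  set x := X.toReal
  set η := H.toReal
  have hx0 : 0 ≤ x := ENNReal.toReal_nonneg
  have hη0 : 0 ≤ η := ENNReal.toReal_nonneg
  have p1 := Real.rpow_nonneg hm0 (1 - 2 / r)
  have p2 := Real.rpow_nonneg hm0 (1 - 1 / r)
  have p3 := Real.rpow_nonneg hm0 (1 - 1 / q - 1 / r)
  have hmain : x ^ 2 ≤ C * (2 * (x ^ 2 * m ^ (1 - 2 / r)) +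
      x * (a * m ^ (1 - 1 / r) + η * m ^ (1 - 1 / q - 1 / r))) := by
    rw [← ENNReal.ofReal_le_ofReal_iff (by positivity), ENNReal.ofReal_pow hx0,
      ENNReal.ofReal_toReal hXt]
    refine hX.trans ?_
    rw [ENNReal.ofReal_mul hC.le]
    gcongr
    refine (add_le_add (add_le_add i2 (j1.trans (add_le_add i2 (mul_le_mul_right i1 _))))
      (j2.trans ih)).trans (le_of_eq ?_)
    rw [← ENNReal.ofReal_pow hx0, ← ENNReal.ofReal_mul (by positivity),
      ← ENNReal.ofReal_mul (by positivity), ← ENNReal.ofReal_mul (by positivity),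
      ← ENNReal.ofReal_mul (by positivity), ← ENNReal.ofReal_mul (by positivity),
      ← ENNReal.ofReal_add (by positivity) (by positivity),
      ← ENNReal.ofReal_add (by positivity) (by positivity),
      ← ENNReal.ofReal_add (by positivity) (by positivity)]
    congr 1
    ring
  have hxle := le_of_sq_le_mul_sq_add hx0 hm2 hC.le (by positivity) hmain
  have hfin : (b - a) * (ν {x | b < |u x|}).toReal ≤ x * m ^ (1 - 1 / r) := by
    have := ENNReal.toReal_mono (by finiteness) (jb.trans i1)
    rwa [ENNReal.toReal_mul, ENNReal.toReal_mul, ENNReal.toReal_ofReal hx0,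
      ENNReal.toReal_ofReal p2, ENNReal.toReal_ofReal (by linarith)] at this
  rcases hm0.eq_or_lt with hm00 | hmpos
  · have : (b - a) * (ν {x | b < |u x|}).toReal ≤ 0 := by
      have hb : ν {x | b < |u x|} ≤ ν A := measure_mono fun x hx => hab.trans hx
      have : (ν {x | b < |u x|}).toReal ≤ 0 := hm00 ▸ ENNReal.toReal_mono hmt hb
      exact mul_nonpos_of_nonneg_of_nonpos (by linarith) this
    exact this.trans (by positivity)
  -- Since `m ≤ 1`, the term with `a` may be given the smaller exponent of the term with `h`.
  have hpow : m ^ (1 - 1 / r) ≤ m ^ (1 - 1 / q - 1 / r) :=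
    Real.rpow_le_rpow_of_exponent_ge hmpos hm1' (by
      have : 0 < 1 / q := by positivity
      linarith)
  calc _ ≤ x * m ^ (1 - 1 / r) := hfin
    _ ≤ (2 * C * (a * m ^ (1 - 1 / q - 1 / r) + η * m ^ (1 - 1 / q - 1 / r))) *
        m ^ (1 - 1 / r) := by
        gcongr
        refine hxle.trans ?_
        gcongr
    _ = 2 * C * (a + η) * (m ^ (1 - 1 / q - 1 / r) * m ^ (1 - 1 / r)) := by ring
    _ = _ := by
        rw [← Real.rpow_add hmpos]
        congr 2
        ring

/-- With `θ = 2^(-1/β)` one has `θ^β = 1/2`, so the superlinear power gains `2^(-n)` along the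
ansatz `y n ≤ y 0 * θ^n`, exactly cancelling the growing factor `2^n`. -/
theorem tendsto_zero_of_le_rpow {y : ℕ → ℝ} {D β : ℝ} (hD : 0 ≤ D) (hβ : 0 < β)
    (hy : ∀ n, 0 ≤ y n) (h : ∀ n, y (n + 1) ≤ D * 2 ^ n * y n ^ (1 + β))
    (h0 : D * y 0 ^ β ≤ 2 ^ (-1 / β)) : Tendsto y atTop (𝓝 0) := by
  set θ : ℝ := 2 ^ (-1 / β) with hθ
  have hθ0 : 0 < θ := by positivity
  have hθ1 : θ < 1 := Real.rpow_lt_one_of_one_lt_of_neg one_lt_two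
    (div_neg_of_neg_of_pos (by norm_num) hβ)
  have hθβ : θ ^ β = 2⁻¹ := by
    rw [hθ, ← Real.rpow_mul (by norm_num), div_mul_cancel₀ _ hβ.ne', Real.rpow_neg_one]
  have key : ∀ n, y n ≤ y 0 * θ ^ n := by
    intro n
    induction n with
    | zero => simp
    | succ n ih =>
      have e1 : (y 0 * θ ^ n) ^ (1 + β) = y 0 * y 0 ^ β * (θ ^ n * (2⁻¹) ^ n) := by
        rw [Real.mul_rpow (hy 0) (by positivity), Real.rpow_one_add' (hy 0) (by linarith),
          Real.rpow_one_add' (by positivity) (by linarith), ← Real.rpow_natCast θ n,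
          ← Real.rpow_mul hθ0.le, mul_comm (n : ℝ) β, Real.rpow_mul hθ0.le, hθβ,
          Real.rpow_natCast, Real.rpow_natCast]
      calc y (n + 1) ≤ D * 2 ^ n * y n ^ (1 + β) := h n
        _ ≤ D * 2 ^ n * (y 0 * θ ^ n) ^ (1 + β) := by gcongr; exact hy n
        _ = (D * y 0 ^ β) * (y 0 * θ ^ n) * (2 ^ n * (2⁻¹) ^ n) := by rw [e1]; ring
        _ = (D * y 0 ^ β) * (y 0 * θ ^ n) := by rw [← mul_pow]; norm_num
        _ ≤ θ * (y 0 * θ ^ n) := by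
          gcongr
          exact mul_nonneg (hy 0) (by positivity)
        _ = y 0 * θ ^ (n + 1) := by ring
  refine squeeze_zero hy key ?_
  simpa using (tendsto_pow_atTop_nhds_zero_of_lt_one hθ0.le hθ1).const_mul (y 0)

theorem exists_forall_mul_rpow_le {c e κ : ℝ} (hc : 0 < c) (he : 0 < e) (hκ : 0 < κ) :
    ∃ m₀ : ℝ, 0 < m₀ ∧ m₀ ≤ 1 ∧ ∀ m, 0 ≤ m → m ≤ m₀ → c * m ^ e ≤ κ := by
  refine ⟨min 1 ((κ / c) ^ (1 / e)), by positivity, min_le_left _ _, fun m hm hm' => ?_⟩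
  have h1 : m ^ e ≤ κ / c := by
    calc m ^ e ≤ ((κ / c) ^ (1 / e)) ^ e := by
          gcongr
          exact hm'.trans (min_le_right _ _)
      _ = κ / c := by
          rw [← Real.rpow_mul (by positivity), one_div_mul_cancel he.ne', Real.rpow_one]
  rwa [le_div_iff₀' hc] at h1

/-- The Markov inequality at a level proportional to the `L_2`-norm. -/
theorem measure_level_le {α : Type*} [MeasurableSpace α] {μ : Measure α} {u : α → ℝ}
    (hu : MemLp u 2 μ) {m₀ N a : ℝ} (hm₀ : 0 < m₀) (hN : 0 < N)
    (huN : (eLpNorm u 2 μ).toReal ≤ N) (ha : N / √m₀ ≤ a) :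
    μ {x | a < |u x|} ≤ ENNReal.ofReal m₀ := by
  have hs : 0 < √m₀ := Real.sqrt_pos.2 hm₀
  have ha0 : 0 < a := lt_of_lt_of_le (by positivity) ha
  refine (measure_lt_abs_le hu.1 ha0).trans ?_
  rw [← Real.sq_sqrt hm₀.le, ENNReal.ofReal_pow hs.le]
  gcongr
  rw [← ENNReal.ofReal_toReal hu.2.ne, ← ENNReal.ofReal_div_of_pos ha0]
  refine ENNReal.ofReal_le_ofReal ?_
  rw [div_le_iff₀ ha0]
  rw [div_le_iff₀ hs] at ha
  linarith

theorem SobolevBound.eLpNorm_top_le (d : ℕ) {C r q : ℝ} (hC : 0 < C) (hr : 2 < r) (hq : 1 < q)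
    (hqr : 1 / q + 2 / r < 1) : ∃ Λ : ℝ, 0 < Λ ∧
    ∀ (Ω : Set (EuclideanSpace ℝ (Fin d))) (h u : EuclideanSpace ℝ (Fin d) → ℝ),
      SobolevBound Ω C r h u → MemLp u 2 (volume.restrict Ω) →
      MemLp h (ENNReal.ofReal q) (volume.restrict Ω) →
      eLpNorm u ⊤ (volume.restrict Ω) ≤ ENNReal.ofReal Λ *
        (eLpNorm u 2 (volume.restrict Ω) + eLpNorm h (ENNReal.ofReal q) (volume.restrict Ω)) := by
  set β := 1 - 1 / q - 2 / r with hβ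
  have hβ0 : 0 < β := by linarith
  have hr1 : 2 / r = 2 * (1 / r) := by ring
  have hrp : 0 < 1 / r := by positivity
  have e1 : 0 < 1 - 2 / r := by rw [sub_pos, div_lt_one (by linarith)]; exact hr
  obtain ⟨m₁, hm₁, hm₁1, hm₁'⟩ := exists_forall_mul_rpow_le (c := 4 * C) (by positivity) e1 one_pos
  obtain ⟨m₂, hm₂, -, hm₂'⟩ := exists_forall_mul_rpow_le (c := 12 * C) (by positivity) hβ0
    (by positivity : (0 : ℝ) < 2 ^ (-1 / β))
  set m₀ := min m₁ m₂
  have hm₀ : 0 < m₀ := lt_min hm₁ hm₂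
  have hm₀1 : m₀ ≤ 1 := (min_le_left _ _).trans hm₁1
  have hs : 0 < √m₀ := Real.sqrt_pos.2 hm₀
  have hs1 : √m₀ ≤ 1 := Real.sqrt_le_one.2 hm₀1
  refine ⟨2 / √m₀, by positivity, fun Ω h u hS hu hh => ?_⟩
  set ν := volume.restrict Ω
  set N := (eLpNorm u 2 ν).toReal + (eLpNorm h (ENNReal.ofReal q) ν).toReal with hN
  have hu0 : 0 ≤ (eLpNorm u 2 ν).toReal := ENNReal.toReal_nonneg
  have hh0 : 0 ≤ (eLpNorm h (ENNReal.ofReal q) ν).toReal := ENNReal.toReal_nonneg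
  rcases (add_nonneg hu0 hh0).eq_or_lt with hN0 | hN0
  · have : eLpNorm u 2 ν = 0 := by
      have h1 : (eLpNorm u 2 ν).toReal = 0 := by linarith
      exact ((ENNReal.toReal_eq_zero_iff _).1 h1).resolve_right hu.2.ne
    rw [eLpNorm_eq_zero_iff hu.1 (by simp)] at this
    rw [eLpNorm_congr_ae this]
    simp
  set K := N / √m₀ with hK
  have hKN : N ≤ K := by rw [hK, le_div_iff₀ hs]; nlinarith
  have hK0 : 0 < K := hN0.trans_le hKN
  -- The levels increase from `K` to `2K`, and Markov's inequality at `K` makes the first measure at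
  -- most `m₀`. As `a n ≤ 2K` and `‖h‖_q ≤ K`, the level-set estimate has constant `2C · 3K`;
  -- dividing by the gap `K/2^(n+1)` gives `12 C 2^n`.
  set a : ℕ → ℝ := fun n => K * (2 - (1 / 2) ^ n) with ha
  have hpow : ∀ n : ℕ, (0 : ℝ) < (1 / 2) ^ n ∧ ((1 : ℝ) / 2) ^ n ≤ 1 := fun n =>
    ⟨by positivity, pow_le_one₀ (by norm_num) (by norm_num)⟩
  have haK : ∀ n, K ≤ a n := fun n => by simp only [ha]; nlinarith [hpow n]
  have ha2 : ∀ n, a n ≤ 2 * K := fun n => by simp only [ha]; nlinarith [hpow n]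
  have hνa : ∀ n, ν {x | a n < |u x|} ≤ ENNReal.ofReal m₀ := fun n =>
    measure_level_le hu hm₀ hN0 (by linarith) (haK n)
  set y : ℕ → ℝ := fun n => (ν {x | a n < |u x|}).toReal with hy
  have hy0 : ∀ n, 0 ≤ y n := fun n => ENNReal.toReal_nonneg
  have hym : ∀ n, y n ≤ m₀ := fun n => ENNReal.toReal_le_of_le_ofReal hm₀.le (hνa n)
  have hrec : ∀ n, y (n + 1) ≤ 12 * C * 2 ^ n * y n ^ (1 + β) := by
    intro n
    have hdiff : a (n + 1) - a n = K * (1 / 2) ^ (n + 1) := by simp only [ha]; ring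
    have := hS.level_set hC hr hq (by linarith) hu.1 hh (hK0.le.trans (haK n))
      (b := a (n + 1)) (by have := mul_pos hK0 (hpow (n + 1)).1; linarith)
      ((hνa n).trans (by simpa using hm₀1))
      (hm₁' _ (hy0 n) ((hym n).trans (min_le_left _ _)))
    rw [hdiff, show 2 - 1 / q - 2 / r = 1 + β by rw [hβ]; ring] at this
    have h2 : K * (1 / 2) ^ (n + 1) * y (n + 1) ≤ 2 * C * (3 * K) * y n ^ (1 + β) := by
      refine this.trans ?_
      have := Real.rpow_nonneg (hy0 n) (1 + β)
      gcongr
      linarith [ha2 n]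
    have h3 : K * (1 / 2) ^ (n + 1) * (12 * C * 2 ^ n * y n ^ (1 + β)) =
        2 * C * (3 * K) * y n ^ (1 + β) * ((1 / 2) ^ n * 2 ^ n) := by ring
    rw [← mul_pow] at h3
    norm_num at h3
    refine le_of_mul_le_mul_left (h2.trans (le_of_eq ?_)) (by positivity : 0 < K * (1 / 2) ^ (n + 1))
    rw [← h3]
  have hlim := tendsto_zero_of_le_rpow (by positivity) hβ0 hy0 hrec
    (hm₂' _ (hy0 0) ((hym 0).trans (min_le_right _ _)))
  have hzero : ν {x | 2 * K < |u x|} = 0 := by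
    have hle : ∀ n, ν {x | 2 * K < |u x|} ≤ ENNReal.ofReal (y n) := fun n => by
      rw [ENNReal.ofReal_toReal (ne_top_of_le_ne_top ENNReal.ofReal_ne_top (hνa n))]
      exact measure_mono fun x hx => (ha2 n).trans_lt hx
    have := ge_of_tendsto' (ENNReal.tendsto_ofReal hlim) hle
    simpa using this
  have hae : ∀ᵐ x ∂ν, ‖u x‖ ≤ 2 * K := by
    rw [ae_iff]
    simpa using hzero
  rw [eLpNorm_exponent_top]
  refine (eLpNormEssSup_le_of_ae_bound hae).trans (le_of_eq ?_)
  rw [← ENNReal.ofReal_toReal hu.2.ne, ← ENNReal.ofReal_toReal hh.2.ne,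
    ← ENNReal.ofReal_add hu0 hh0, ← ENNReal.ofReal_mul (by positivity), ← hN, hK]
  congr 1
  ring

/-! ### Truncated powers and the bound for `q < d/2` -/

/-- The derivative of a truncation of `|s|^k` which is linear for `|s| ≥ M`. -/
noncomputable def powerWeight (k M s : ℝ) : ℝ := k * min |s| M ^ (k - 1)

theorem continuous_powerWeight {k : ℝ} (hk : 1 ≤ k) (M : ℝ) : Continuous (powerWeight k M) :=
  continuous_const.mul ((continuous_abs.min continuous_const).rpow_const fun _ => .inr (by linarith))

theorem isWeight_powerWeight {k M : ℝ} (hk : 1 ≤ k) (hM : 0 ≤ M) : IsWeight (powerWeight k M) := by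
  have h0 : ∀ s, 0 ≤ powerWeight k M s := fun s => by unfold powerWeight; positivity
  refine ⟨⟨fun _ => powerWeight k M, k * M ^ (k - 1), fun _ => continuous_powerWeight hk M,
    fun _ s => ?_, fun s => tendsto_const_nhds⟩, h0, fun s t hst => ?_⟩
  · rw [abs_of_nonneg (h0 s)]
    unfold powerWeight
    gcongr
    exact min_le_right _ _
  · unfold powerWeight
    gcongr

theorem integral_mul_rpow {k c S : ℝ} (hk : 1 ≤ k) :
    ∫ t in (0 : ℝ)..S, c * (k * t ^ (k - 1)) = c * S ^ k := by
  rw [intervalIntegral.integral_const_mul, intervalIntegral.integral_const_mul,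
    integral_rpow (.inl (by linarith)), sub_add_cancel, Real.zero_rpow (by linarith)]
  field_simp
  ring

theorem intervalIntegrable_mul_rpow {k c : ℝ} (hk : 1 ≤ k) (S : ℝ) :
    IntervalIntegrable (fun t : ℝ => c * (k * t ^ (k - 1))) volume 0 S :=
  ((intervalIntegral.intervalIntegrable_rpow (.inl (by linarith))).const_mul k).const_mul c

theorem abs_primitive_powerWeight_le {k M : ℝ} (hk : 1 ≤ k) (hM : 0 ≤ M) (s : ℝ) :
    |primitive (powerWeight k M) s| ≤ |s| ^ k := by
  have hw := isWeight_powerWeight hk hM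
  rw [hw.abs_primitive, ← one_mul (|s| ^ k), ← integral_mul_rpow hk]
  refine intervalIntegral.integral_mono_on (abs_nonneg s) (hw.intervalIntegrable _ _)
    (intervalIntegrable_mul_rpow hk _) fun t ht => ?_
  rw [one_mul]
  unfold powerWeight
  rw [abs_of_nonneg ht.1]
  gcongr
  exacts [le_min ht.1 hM, min_le_left _ _]

/-- On `[0, S]` with `S = |s|`, concavity gives `min t M ≥ (t/S) min S M`; raising this to the power
`k - 1` and integrating gives the claim. -/
theorem abs_mul_powerWeight_le {k M : ℝ} (hk : 1 ≤ k) (hM : 0 ≤ M) (s : ℝ) :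
    |s| * powerWeight k M s ≤ k * |primitive (powerWeight k M) s| := by
  have hw := isWeight_powerWeight hk hM
  rcases (abs_nonneg s).eq_or_lt with hs | hs
  · rw [← hs, zero_mul]
    positivity
  set S := |s| with hS
  have key : (min S M / S) ^ (k - 1) * S ^ k ≤ |primitive (powerWeight k M) s| := by
    rw [hw.abs_primitive, ← integral_mul_rpow hk]
    refine intervalIntegral.integral_mono_on hs.le (intervalIntegrable_mul_rpow hk _)
      (hw.intervalIntegrable _ _) fun t ht => ?_
    unfold powerWeight
    rw [abs_of_nonneg ht.1, mul_left_comm, ← Real.mul_rpow (by positivity) ht.1]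
    gcongr
    · exact mul_nonneg (by positivity) ht.1
    · rw [div_mul_eq_mul_div, div_le_iff₀ hs]
      rcases le_total t M with h | h
      · rw [min_eq_left h, mul_comm]
        exact mul_le_mul_of_nonneg_left (min_le_left _ _) ht.1
      · rw [min_eq_right h]
        exact mul_le_mul (min_le_right _ _) ht.2 ht.1 hM
  have e : (min S M / S) ^ (k - 1) * S ^ k = S * min S M ^ (k - 1) := by
    rw [Real.div_rpow (by positivity) hs.le, div_mul_eq_mul_div,
      div_eq_iff (by positivity)]
    have : S ^ k = S * S ^ (k - 1) := by
      rw [← Real.rpow_one_add' hs.le (by linarith)]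
      congr 1
      ring
    rw [this]
    ring
  rw [e] at key
  calc S * (k * min S M ^ (k - 1)) = k * (S * min S M ^ (k - 1)) := by ring
    _ ≤ _ := by gcongr

theorem abs_primitive_powerWeight_eq {k M : ℝ} (hk : 1 ≤ k) {s : ℝ} (hs : |s| ≤ M) :
    |primitive (powerWeight k M) s| = |s| ^ k := by
  have hM := (abs_nonneg s).trans hs
  refine le_antisymm (abs_primitive_powerWeight_le hk hM s) ?_
  have h := abs_mul_powerWeight_le hk hM s
  unfold powerWeight at h
  rw [min_eq_left hs, mul_left_comm, ← Real.rpow_one_add' (abs_nonneg s) (by linarith),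
    add_sub_cancel] at h
  exact le_of_mul_le_mul_left h (by linarith)

/-- Writing `g` for the modulus of the primitive, `g ≤ |s|^k` yields `g^(1/k) ρ ≤ |s| ρ ≤ k g`. This
exchanges the weight for a power of `g` uniformly in `M`. -/
theorem powerWeight_le {k M : ℝ} (hk : 1 ≤ k) (hM : 0 ≤ M) (s : ℝ) :
    |primitive (powerWeight k M) s| * powerWeight k M s ≤
      k * |primitive (powerWeight k M) s| ^ (2 - 1 / k) := by
  have h1 := abs_primitive_powerWeight_le hk hM s
  have h2 := abs_mul_powerWeight_le hk hM s
  set g := |primitive (powerWeight k M) s|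
  have hg : 0 ≤ g := abs_nonneg _
  have hk1 : 1 / k ≤ 1 := by rw [div_le_one (by linarith)]; exact hk
  rcases hg.eq_or_lt with hg0 | hg0
  · rw [← hg0, zero_mul]
    positivity
  have h3 : g ^ (1 / k) ≤ |s| := by
    calc g ^ (1 / k) ≤ (|s| ^ k) ^ (1 / k) := by gcongr
      _ = |s| := by rw [← Real.rpow_mul (abs_nonneg s), mul_one_div_cancel (by linarith),
        Real.rpow_one]
  have hw0 := (isWeight_powerWeight hk hM).nonneg s
  have h4 : g ^ (1 / k) * powerWeight k M s ≤ k * g :=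
    (mul_le_mul_of_nonneg_right h3 hw0).trans h2
  have e : g ^ (2 - 1 / k) = g * g / g ^ (1 / k) := by
    rw [Real.rpow_sub hg0, Real.rpow_two, pow_two]
  rw [e, ← mul_div_assoc, le_div_iff₀ (by positivity)]
  nlinarith

/-- In terms of `Y = X^(1/k)` the hypothesis is homogeneous of degree `2k`. If `Y > u + h`, both
terms on the right contain a factor at most `(u+h) Y^(2k-1)`, and dividing by `Y^(2k-1)` leaves a
linear bound. -/
theorem le_of_sq_le_rpow {X u h P Q k : ℝ} (hk : 1 ≤ k) (hX : 0 ≤ X) (hu : 0 ≤ u) (hh : 0 ≤ h)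
    (hP : 0 ≤ P) (hQ : 0 ≤ Q) (H : X ^ 2 ≤ P * u ^ (2 * k) + Q * (h * X ^ (2 - 1 / k))) :
    X ≤ ((1 + P + Q) * (u + h)) ^ k := by
  set Y := X ^ (1 / k) with hY
  have hY0 : 0 ≤ Y := by positivity
  have hXY : ∀ e : ℝ, X ^ e = Y ^ (k * e) := fun e => by
    rw [hY, ← Real.rpow_mul hX, ← mul_assoc, one_div_mul_cancel (by linarith), one_mul]
  have hX1 : X = Y ^ k := by simpa using hXY 1
  suffices hYle : Y ≤ (1 + P + Q) * (u + h) by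
    rw [hX1]
    gcongr
  have hPQ : 0 ≤ (P + Q) * (u + h) := by positivity
  by_cases hYN : Y ≤ u + h
  · linarith
  push Not at hYN
  have hYpos : 0 < Y := (add_nonneg hu hh).trans_lt hYN
  have e1 : X ^ 2 = Y * Y ^ (2 * k - 1) := by
    rw [← Real.rpow_two, hXY, ← Real.rpow_one_add' hY0 (by linarith)]
    congr 1
    ring
  have e2 : X ^ (2 - 1 / k) = Y ^ (2 * k - 1) := by
    rw [hXY]
    congr 1
    field_simp
  have e3 : u ^ (2 * k) ≤ (u + h) * Y ^ (2 * k - 1) := by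
    have : u ^ (2 * k) = u * u ^ (2 * k - 1) := by
      rw [← Real.rpow_one_add' hu (by linarith)]
      congr 1
      ring
    rw [this]
    gcongr
    · linarith
    · linarith
    · linarith
  have hZ : 0 < Y ^ (2 * k - 1) := by positivity
  rw [e1, e2] at H
  have H2 : Y * Y ^ (2 * k - 1) ≤ ((P + Q) * (u + h)) * Y ^ (2 * k - 1) := by
    have a1 := mul_le_mul_of_nonneg_left e3 hP
    have a2 : Q * (h * Y ^ (2 * k - 1)) ≤ Q * ((u + h) * Y ^ (2 * k - 1)) := by
      gcongr
      linarith
    linarith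
  have := le_of_mul_le_mul_right H2 hZ
  nlinarith

theorem SobolevBound.power_le {C r q p k M m₀ : ℝ} {h u : EuclideanSpace ℝ (Fin d) → ℝ}
    (hS : SobolevBound Ω C r h u) (hC : 0 < C) (hr : 2 < r) (hk : 1 ≤ k)
    (hpq : p.HolderConjugate q) (hpk : p * (2 - 1 / k) = r) (hM : 0 ≤ M) (hm₀ : 0 < m₀)
    (hm₀' : ∀ m, 0 ≤ m → m ≤ m₀ → 2 * C * (1 + k) * m ^ (1 - 2 / r) ≤ 1)
    (hu : MemLp u 2 (volume.restrict Ω)) (hu0 : 0 < (eLpNorm u 2 (volume.restrict Ω)).toReal)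
    (hh : MemLp h (ENNReal.ofReal q) (volume.restrict Ω)) :
    eLpNorm (fun x => primitive (powerWeight k M) (u x)) (ENNReal.ofReal r) (volume.restrict Ω) ≤
      ENNReal.ofReal (((1 + 2 * C * (1 + k) * (1 / √m₀) ^ (2 * k - 2) + 2 * C * k) *
        ((eLpNorm u 2 (volume.restrict Ω)).toReal +
          (eLpNorm h (ENNReal.ofReal q) (volume.restrict Ω)).toReal)) ^ k) := by
  have hw := isWeight_powerWeight hk hM
  obtain ⟨hXt, hX⟩ := hS _ hw
  set ν := volume.restrict Ω
  set g := primitive (powerWeight k M) with hg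
  set U := (eLpNorm u 2 ν).toReal
  have hgc : Continuous g := by
    obtain ⟨B, hB⟩ := hw.boundedLimit.exists_bound
    exact continuous_primitive hw.boundedLimit.measurable hB
  have hgm : AEStronglyMeasurable (fun x => g (u x)) ν := hgc.comp_aestronglyMeasurable hu.1
  -- Above `s₀` the set has measure at most `m₀`; below it `|u|^(2k) ≤ s₀^(2k-2) |u|²`. Taking `s₀`
  -- proportional to `‖u‖_2` keeps the estimate homogeneous.
  set s₀ := U / √m₀ with hs₀
  have hs : 0 < √m₀ := Real.sqrt_pos.2 hm₀
  have hs₀0 : 0 < s₀ := by positivity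
  have hνA := measure_level_le hu hm₀ hu0 le_rfl hs₀.ge
  have hr0 : 0 < 1 - 2 / r := by rw [sub_pos, div_lt_one (by linarith)]; exact hr
  have hk1 : 1 / k ≤ 1 := by rw [div_le_one (by linarith)]; exact hk
  have he : 0 < 2 - 1 / k := by linarith
  set w : EuclideanSpace ℝ (Fin d) → ℝ := fun x => if s₀ < |u x| then g (u x) else 0 with hwdef
  have hwm : AEStronglyMeasurable w ν := by
    have : Measurable fun s => if s₀ < |s| then g s else 0 :=
      Measurable.ite (measurableSet_lt measurable_const measurable_id.abs) hgc.measurable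
        measurable_const
    exact (this.comp_aemeasurable hu.1.aemeasurable).aestronglyMeasurable
  have hwA : w.support ⊆ {x | s₀ < |u x|} := fun x hx => by
    by_contra hcon
    exact hx (if_neg hcon)
  have hwg : ∀ x, ‖w x‖ ≤ ‖g (u x)‖ := fun x => by
    simp only [hwdef]
    split_ifs <;> simp
  have i2 : ∫⁻ x, ‖w x‖ₑ ^ 2 ∂ν ≤ eLpNorm (fun x => g (u x)) (ENNReal.ofReal r) ν ^ 2 *
      ENNReal.ofReal (m₀ ^ (1 - 2 / r)) := by
    refine (lintegral_enorm_sq_le_of_support_subset hwm hwA hr.le).trans ?_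
    rw [← ENNReal.ofReal_rpow_of_nonneg hm₀.le hr0.le]
    gcongr
    exact eLpNorm_mono hwg
  have i1 : ∫⁻ x, ‖g (u x)‖ₑ ^ 2 ∂ν ≤
      ENNReal.ofReal (s₀ ^ (2 * k - 2)) * ENNReal.ofReal (U ^ 2) + ∫⁻ x, ‖w x‖ₑ ^ 2 ∂ν := by
    rw [ENNReal.ofReal_pow ENNReal.toReal_nonneg, ENNReal.ofReal_toReal hu.2.ne, eLpNorm_two_sq,
      ← lintegral_const_mul' _ _ ENNReal.ofReal_ne_top,
      ← lintegral_add_right' _ (hwm.enorm.pow_const 2)]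
    refine lintegral_mono fun x => ?_
    by_cases hx : s₀ < |u x|
    · simp [hwdef, hx]
    · refine le_add_right ?_
      push Not at hx
      simp only [Real.enorm_eq_ofReal_abs]
      rw [← ENNReal.ofReal_pow (abs_nonneg _), ← ENNReal.ofReal_pow (abs_nonneg _),
        ← ENNReal.ofReal_mul (by positivity)]
      refine ENNReal.ofReal_le_ofReal ?_
      calc |g (u x)| ^ 2 ≤ (|u x| ^ k) ^ 2 := by
            gcongr
            exact abs_primitive_powerWeight_le hk hM _
        _ = |u x| ^ (2 * k - 2) * |u x| ^ 2 := by
            rw [← Real.rpow_natCast, ← Real.rpow_natCast (|u x|) 2, ← Real.rpow_mul (abs_nonneg _),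
              ← Real.rpow_add' (abs_nonneg _) (by push_cast; linarith)]
            congr 1
            push_cast
            ring
        _ ≤ _ := by gcongr; linarith
  have j1 : ∫⁻ x, ‖g (u x)‖ₑ * ‖powerWeight k M (u x)‖ₑ * ‖u x‖ₑ ∂ν ≤
      ENNReal.ofReal k * ∫⁻ x, ‖g (u x)‖ₑ ^ 2 ∂ν := by
    rw [← lintegral_const_mul' _ _ ENNReal.ofReal_ne_top]
    refine lintegral_mono fun x => ?_
    simp only [Real.enorm_eq_ofReal_abs, abs_of_nonneg (hw.nonneg _)]
    rw [← ENNReal.ofReal_mul (abs_nonneg _),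
      ← ENNReal.ofReal_mul (mul_nonneg (abs_nonneg _) (hw.nonneg _)),
      ← ENNReal.ofReal_pow (abs_nonneg _), ← ENNReal.ofReal_mul (by linarith)]
    refine ENNReal.ofReal_le_ofReal ?_
    nlinarith [abs_mul_powerWeight_le hk hM (u x), abs_nonneg (g (u x))]
  have j2 : ∫⁻ x, ‖g (u x)‖ₑ * ‖powerWeight k M (u x)‖ₑ * ‖h x‖ₑ ∂ν ≤
      ENNReal.ofReal k * (eLpNorm (fun x => g (u x)) (ENNReal.ofReal r) ν ^ (2 - 1 / k) *
        eLpNorm h (ENNReal.ofReal q) ν) := by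
    have hpm : AEStronglyMeasurable (fun x => ‖g (u x)‖ ^ (2 - 1 / k)) ν :=
      (hgm.norm.aemeasurable.pow_const _).aestronglyMeasurable
    -- The relation `p(2 - 1/k) = r` turns the `L_p`-norm of the power of `|g(u)|` into a power of
    -- its `L_r`-norm.
    have hH := lintegral_enorm_mul_le hpm hh.1 hpq
    rw [eLpNorm_norm_rpow _ he, ← ENNReal.ofReal_mul hpq.nonneg, hpk] at hH
    refine le_trans ?_ (mul_le_mul_right hH _)
    rw [← lintegral_const_mul' _ _ ENNReal.ofReal_ne_top]
    refine lintegral_mono fun x => ?_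
    rw [← mul_assoc]
    gcongr ?_ * _
    simp only [Real.enorm_eq_ofReal_abs, abs_of_nonneg (hw.nonneg _)]
    rw [← ENNReal.ofReal_mul (abs_nonneg _), ← ENNReal.ofReal_mul (by linarith),
      abs_of_nonneg (by positivity : 0 ≤ ‖g (u x)‖ ^ (2 - 1 / k))]
    exact ENNReal.ofReal_le_ofReal (powerWeight_le hk hM (u x))
  set X := eLpNorm (fun x => g (u x)) (ENNReal.ofReal r) ν
  set H := eLpNorm h (ENNReal.ofReal q) ν
  have hHt : H ≠ ⊤ := hh.2.ne
  have hx0 : 0 ≤ X.toReal := ENNReal.toReal_nonneg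
  have hη0 : 0 ≤ H.toReal := ENNReal.toReal_nonneg
  rw [← ENNReal.ofReal_toReal hXt] at i2 hX j2
  rw [← ENNReal.ofReal_toReal hHt] at j2
  set x := X.toReal
  set η := H.toReal
  have hk0 : 0 ≤ k := by linarith
  have hmain : x ^ 2 ≤ C * ((s₀ ^ (2 * k - 2) * U ^ 2 + x ^ 2 * m₀ ^ (1 - 2 / r)) +
      k * (s₀ ^ (2 * k - 2) * U ^ 2 + x ^ 2 * m₀ ^ (1 - 2 / r)) +
      k * (x ^ (2 - 1 / k) * η)) := by
    have i3 : ∫⁻ x, ‖g (u x)‖ₑ ^ 2 ∂ν ≤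
        ENNReal.ofReal (s₀ ^ (2 * k - 2) * U ^ 2 + x ^ 2 * m₀ ^ (1 - 2 / r)) := by
      refine (i1.trans (add_le_add_right i2 _)).trans (le_of_eq ?_)
      rw [← ENNReal.ofReal_pow hx0, ← ENNReal.ofReal_mul (by positivity),
        ← ENNReal.ofReal_mul (by positivity), ← ENNReal.ofReal_add (by positivity) (by positivity)]
    rw [← ENNReal.ofReal_le_ofReal_iff (by positivity), ENNReal.ofReal_pow hx0]
    refine hX.trans ?_
    rw [ENNReal.ofReal_mul hC.le, ENNReal.ofReal_add (by positivity) (by positivity),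
      ENNReal.ofReal_add (by positivity) (by positivity)]
    gcongr
    · refine (j1.trans (mul_le_mul_right i3 _)).trans (le_of_eq ?_)
      rw [← ENNReal.ofReal_mul hk0]
    · refine j2.trans (le_of_eq ?_)
      rw [ENNReal.ofReal_rpow_of_nonneg hx0 he.le, ← ENNReal.ofReal_mul (by positivity),
        ← ENNReal.ofReal_mul hk0]
  have hsU : s₀ ^ (2 * k - 2) * U ^ 2 = (1 / √m₀) ^ (2 * k - 2) * U ^ (2 * k) := by
    rw [hs₀, div_eq_mul_one_div, Real.mul_rpow hu0.le (by positivity), ← Real.rpow_natCast U 2,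
      mul_right_comm, ← Real.rpow_add hu0, mul_comm]
    congr 2
    push_cast
    ring
  -- The choice of `m₀` lets half of `x²` be absorbed; this is legitimate because `SobolevBound`
  -- includes finiteness of the `L_r`-norm.
  have habs : 2 * C * (1 + k) * m₀ ^ (1 - 2 / r) * x ^ 2 ≤ 1 * x ^ 2 := by
    gcongr
    exact hm₀' m₀ hm₀.le le_rfl
  rw [hsU] at hmain
  rw [← ENNReal.ofReal_toReal hXt]
  refine ENNReal.ofReal_le_ofReal (le_of_sq_le_rpow hk hx0 hu0.le hη0 (by positivity)
    (by positivity) ?_)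
  nlinarith

theorem SobolevBound.eLpNorm_le (d : ℕ) {C r q p k : ℝ} (hC : 0 < C) (hr : 2 < r) (hk : 1 ≤ k)
    (hpq : p.HolderConjugate q) (hpk : p * (2 - 1 / k) = r) : ∃ Λ : ℝ, 0 < Λ ∧
    ∀ (Ω : Set (EuclideanSpace ℝ (Fin d))) (h u : EuclideanSpace ℝ (Fin d) → ℝ),
      SobolevBound Ω C r h u → MemLp u 2 (volume.restrict Ω) →
      MemLp h (ENNReal.ofReal q) (volume.restrict Ω) →
      eLpNorm u (ENNReal.ofReal (r * k)) (volume.restrict Ω) ≤ ENNReal.ofReal Λ *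
        (eLpNorm u 2 (volume.restrict Ω) + eLpNorm h (ENNReal.ofReal q) (volume.restrict Ω)) := by
  have hr0 : 0 < 1 - 2 / r := by rw [sub_pos, div_lt_one (by linarith)]; exact hr
  have hk0 : 0 < k := by linarith
  obtain ⟨m₀, hm₀, -, hm₀'⟩ := exists_forall_mul_rpow_le (c := 2 * C * (1 + k)) (by positivity)
    hr0 one_pos
  refine ⟨1 + 2 * C * (1 + k) * (1 / √m₀) ^ (2 * k - 2) + 2 * C * k, by positivity,
    fun Ω h u hS hu hh => ?_⟩
  set ν := volume.restrict Ω
  rcases (ENNReal.toReal_nonneg (a := eLpNorm u 2 ν)).eq_or_lt with hu0 | hu0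
  · have : eLpNorm u 2 ν = 0 :=
      ((ENNReal.toReal_eq_zero_iff _).1 hu0.symm).resolve_right hu.2.ne
    rw [eLpNorm_eq_zero_iff hu.1 (by simp)] at this
    rw [eLpNorm_congr_ae this]
    simp
  have hbound := fun n : ℕ => hS.power_le hC hr hk hpq hpk n.cast_nonneg hm₀ hm₀' hu hu0 hh
  set Λ := 1 + 2 * C * (1 + k) * (1 / √m₀) ^ (2 * k - 2) + 2 * C * k
  have hΛ : 0 < Λ := by positivity
  have hm : ∀ n : ℕ, AEStronglyMeasurable (fun x => ‖primitive (powerWeight k n) (u x)‖) ν := by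
    intro n
    have hw := isWeight_powerWeight hk n.cast_nonneg
    obtain ⟨B, hB⟩ := hw.boundedLimit.exists_bound
    exact ((continuous_primitive hw.boundedLimit.measurable hB).comp_aestronglyMeasurable hu.1).norm
  -- Fatou's lemma as the truncation level `n` tends to infinity: at each `x` the sequence equals
  -- `|u x|^k` as soon as `n ≥ |u x|`.
  have hlim := Lp.eLpNorm_lim_le_liminf_eLpNorm (p := ENNReal.ofReal r) hm (fun x => ‖u x‖ ^ k)
    (.of_forall fun x => by
      refine tendsto_const_nhds.congr' ?_
      filter_upwards [eventually_ge_atTop ⌈|u x|⌉₊] with n hn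
      exact (abs_primitive_powerWeight_eq hk (Nat.ceil_le.1 hn)).symm)
  rw [eLpNorm_norm_rpow _ hk0, ← ENNReal.ofReal_mul (by linarith)] at hlim
  set N := (eLpNorm u 2 ν).toReal + (eLpNorm h (ENNReal.ofReal q) ν).toReal with hN
  have hN0 : 0 ≤ N := add_nonneg hu0.le ENNReal.toReal_nonneg
  have hle : eLpNorm u (ENNReal.ofReal (r * k)) ν ^ k ≤ ENNReal.ofReal (Λ * N) ^ k := by
    rw [ENNReal.ofReal_rpow_of_nonneg (by positivity) hk0.le]
    refine hlim.trans (liminf_le_of_le (by isBoundedDefault) fun b hb => ?_)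
    obtain ⟨n, hn⟩ := hb.exists
    rw [eLpNorm_norm] at hn
    exact hn.trans (hbound n)
  rw [ENNReal.rpow_le_rpow_iff hk0] at hle
  refine hle.trans (le_of_eq ?_)
  rw [ENNReal.ofReal_mul hΛ.le, hN, ENNReal.ofReal_add hu0.le ENNReal.toReal_nonneg,
    ENNReal.ofReal_toReal hu.2.ne, ENNReal.ofReal_toReal hh.2.ne]

/-! ### Exponents and conclusion -/

theorem one_div_add_two_div_sobolevExponent_lt {d : ℕ} {q : ℝ} (hq : 2 ≤ q) (hd : (d : ℝ) / 2 < q) :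
    1 / q + 2 / sobolevExponent d < 1 := by
  -- Since `1 - 2/r = 2/m`, the claim is `q > m/2`; for `d ≤ 3` it follows from `q ≥ 2 > 3/2`.
  have hm : ((max d 3 : ℕ) : ℝ) < 2 * q := by
    rcases le_total d 3 with h | h
    · rw [max_eq_right h]; push_cast; linarith
    · rw [max_eq_left h]; linarith
  have hm0 : (0 : ℝ) < ((max d 3 : ℕ) : ℝ) := by positivity
  have h1 : 1 / q < 2 * (((max d 3 : ℕ) : ℝ))⁻¹ := by
    rw [← div_eq_mul_inv, div_lt_div_iff₀ (by linarith) hm0]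
    linarith
  rw [div_eq_mul_inv 2 (sobolevExponent d), inv_sobolevExponent]
  linarith

theorem exists_qStarStar_eq {d : ℕ} {q : ℝ} (hq : 2 ≤ q) (hd : q < (d : ℝ) / 2) :
    ∃ p k : ℝ, p.HolderConjugate q ∧ 1 ≤ k ∧ p * (2 - 1 / k) = sobolevExponent d ∧
      qStarStar d q = ENNReal.ofReal (sobolevExponent d * k) := by
  have hd4 : (4 : ℝ) < d := by linarith
  have hd3 : 3 ≤ d := by
    have : 4 < d := by exact_mod_cast hd4
    omega
  have hr : sobolevExponent d = 2 * d / (d - 2) := by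
    unfold sobolevExponent
    rw [max_eq_left hd3]
  have h1 : 0 < (d : ℝ) - 2 * q := by linarith
  have h2 : (d : ℝ) - 2 ≠ 0 := by linarith
  have h3 : q - 1 ≠ 0 := by linarith
  have h4 : q ≠ 0 := by linarith
  -- This `k` solves `p(2 - 1/k) = r` for the conjugate exponent `p = q/(q-1)` and `r = 2d/(d-2)`.
  -- The condition `k ≥ 1` amounts to `q ≥ 2d/(d+2)`, which follows from `q ≥ 2`.
  refine ⟨q.conjExponent, q * (d - 2) / (2 * (d - 2 * q)),
    (Real.HolderConjugate.conjExponent (by linarith)).symm, ?_, ?_, ?_⟩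
  · rw [le_div_iff₀ (by linarith)]
    nlinarith
  · rw [hr, Real.conjExponent]
    field_simp
    ring
  · unfold qStarStar
    rw [if_pos hd, hr]
    congr 1
    field_simp

end SemilinearDirichlet

open SemilinearDirichlet in
theorem mainTheorem3 (d : ℕ) (q δ L : ℝ) (hq : 2 ≤ q) (hqd : q ≠ (d : ℝ) / 2)
    (hδ : 0 < δ) (hL : 0 < L) :
    ∃ C : ℝ, 0 < C ∧
      ∀ (Ω : Set (EuclideanSpace ℝ (Fin d))), IsOpen Ω →
      ∀ (f : EuclideanSpace ℝ (Fin d) → ℝ → EuclideanSpace ℝ (Fin d) → ℝ)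
        (h : EuclideanSpace ℝ (Fin d) → ℝ),
        IsCaratheodory Ω f →
        (∀ᵐ x ∂(volume.restrict Ω), 0 ≤ h x) →
        MemLp h 2 (volume.restrict Ω) →
        MemLp h (ENNReal.ofReal q) (volume.restrict Ω) →
        IsCoercive Ω f δ L h →
      ∀ (μ t : ℝ), 0 ≤ μ → 0 < t → t ≤ 1 →
      ∀ (U : Set (EuclideanSpace ℝ (Fin d))), IsOpen U → U ⊆ Ω →
      ∀ (v₀ v₁ : EuclideanSpace ℝ (Fin d) → ℝ),
        AEMeasurable v₀ (volume.restrict Ω) → AEMeasurable v₁ (volume.restrict Ω) →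
        (∀ᵐ x ∂(volume.restrict Ω), v₀ x ≤ 0) → (∀ᵐ x ∂(volume.restrict Ω), 0 ≤ v₁ x) →
      ∀ (u : EuclideanSpace ℝ (Fin d) → ℝ),
        IsWeakSolution Ω μ (truncRHS f μ t U v₀ v₁) u →
        MemLp u (qStarStar d q) (volume.restrict Ω) ∧
        eLpNorm u (qStarStar d q) (volume.restrict Ω) ≤
          ENNReal.ofReal C *
            (eLpNorm u 2 (volume.restrict Ω) +
              eLpNorm h (ENNReal.ofReal q) (volume.restrict Ω)) := by
  obtain ⟨C, hC, hS⟩ := IsWeakSubsolution.sobolevBound d hδ.le hL.le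
  have hr := two_lt_sobolevExponent d
  obtain ⟨Λ, hΛ, hmain⟩ : ∃ Λ : ℝ, 0 < Λ ∧
      ∀ (Ω : Set (EuclideanSpace ℝ (Fin d))) (h u : EuclideanSpace ℝ (Fin d) → ℝ),
        SobolevBound Ω C (sobolevExponent d) h u → MemLp u 2 (volume.restrict Ω) →
        MemLp h (ENNReal.ofReal q) (volume.restrict Ω) →
        eLpNorm u (qStarStar d q) (volume.restrict Ω) ≤ ENNReal.ofReal Λ *
          (eLpNorm u 2 (volume.restrict Ω) +
            eLpNorm h (ENNReal.ofReal q) (volume.restrict Ω)) := by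
    rcases lt_or_gt_of_ne hqd with hlt | hgt
    · obtain ⟨p, k, hpq, hk, hpk, hqs⟩ := exists_qStarStar_eq hq hlt
      rw [hqs]
      exact SobolevBound.eLpNorm_le d hC hr hk hpq hpk
    · have hqs : qStarStar d q = ⊤ := if_neg hgt.not_gt
      rw [hqs]
      exact SobolevBound.eLpNorm_top_le d hC hr (by linarith)
        (one_div_add_two_div_sobolevExponent_lt hq hgt)
  refine ⟨Λ, hΛ, fun Ω _ f h hf hh0 hh2 hhq hc μ t hμ ht ht1 U _ _ v₀ v₁ _ _ hv₀ hv₁ u hu => ?_⟩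
  obtain ⟨G, hG⟩ := isWeakSubsolution_of_isWeakSolution hδ.le hL.le hμ ht.le ht1 hf hh0 hh2 hc
    hv₀ hv₁ hu
  have hu2 := hG.inH10.memLp
  have hle := hmain Ω h u (hS Ω h u G hG) hu2 hhq
  exact ⟨⟨hu2.1, hle.trans_lt (ENNReal.mul_lt_top ENNReal.ofReal_lt_top
    (ENNReal.add_lt_top.2 ⟨hu2.2, hhq.2⟩))⟩, hle⟩
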